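/- Let $A$ be a noetherian commutative ring. A complex $N$ of $A$-modules with bounded cohomology has finite injective dimension if there is a natural number $i_0$ such that $\operatorname{Ext}^i_A(M,N) = \operatorname{H}^i(\operatorname{RHom}_A(M,N)) = 0$ for all $A$-modules $M$ and all $i > i_0$. A dualizing complex over $A$ is a complex $R$ of $A$-modules, with bounded cohomology and with all $\operatorname{H}^i(R)$ finitely generated over $A$, which has finite injective dimension and for which the canonical morphism $\theta : A \to \operatorname{RHom}_A(R,R)$ in $\mathsf{D}(\mathsf{Mod}\,A)$ is an isomorphism; for a K-injective resolution $R \to I$, $\theta$ is represented by the homomorphism $A \to \operatorname{Hom}_A(I,I)$ that sends $a$ to multiplication by $a$. The ring $A$ is called regular if it has finite global cohomological dimension: there is a natural number $d$ such that $\operatorname{Ext}^i_A(M,N) = 0$ for all $A$-modules $M, N$ and all $i > d$. An $A$-algebra is of essentially finite type if it is a localization of a finitely generated commutative $A$-algebra. 1. Let $B$ be a localization of $A$ (that is, $B \cong S^{-1}A$ as $A$-algebras, for some multiplicatively closed subset $S \subset A$), and let $R_A$ be a dualizing complex over $A$. Then $R_B := B \otimes_A R_A$ is a dualizing complex over $B$.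 2. Suppose that $A$ is regular, and let $B$ be an $A$-algebra of essentially finite type. Then $B$ has a dualizing complex. -/

import Mathlib

universe u

open CategoryTheory CochainComplex CochainComplex.HomComplex

noncomputable section

namespace DualizingComplex

/-- Complexes of `A`-modules, indexed by `ℤ`, with differentials of degree `1`. -/
abbrev Complexes (A : Type u) [CommRing A] : Type (u + 1) :=
  CochainComplex (ModuleCat.{u} A) ℤ

/-- The module `M`, seen as a complex concentrated in degree `0`. -/
abbrev inDegreeZero (A : Type u) [CommRing A] (M : ModuleCat.{u} A) : Complexes A :=
  (HomologicalComplex.single (ModuleCat.{u} A) (ComplexShape.up ℤ) 0).obj M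

/-- The complex of `A`-modules `Hom_A(M, N)`. In degree `n` it is the product over `p` of
`Hom_A(M^p, N^(p+n))`, with the pointwise `A`-module structure, and the differential is that of
`CochainComplex.HomComplex`, which Mathlib only regards as a complex of abelian groups. -/
def homComplex {A : Type u} [CommRing A] (M N : Complexes A) : Complexes A where
  X n := ModuleCat.of A (Cochain M N n)
  d i j := ModuleCat.ofHom (δ_hom A M N i j)
  shape i j hij := by
    ext z : 2
    exact δ_shape i j hij z
  d_comp_d' i j k _ _ := by
    ext z : 2
    exact δ_δ i j k z

/-- A K-injective resolution `N → I`. -/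
structure KInjectiveResolution {A : Type u} [CommRing A] (N : Complexes A) where
  /-- the K-injective complex -/
  I : Complexes A
  /-- the augmentation -/
  ι : N ⟶ I
  quasiIso : QuasiIso ι
  isKInjective : I.IsKInjective

/-- `RHom_A(M, N)`, calculated with the K-injective resolution `ρ : N → I`, that is,
`Hom_A(M, I)`. -/
abbrev RHom {A : Type u} [CommRing A] (M : Complexes A) {N : Complexes A}
    (ρ : KInjectiveResolution N) : Complexes A :=
  homComplex M ρ.I

/-- `Ext^i_A(M, N) = H^i(RHom_A(M, N))`, calculated with the K-injective resolution `ρ` of `N`.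
Another resolution gives an isomorphic module. -/
abbrev Ext {A : Type u} [CommRing A] (M : Complexes A) {N : Complexes A}
    (ρ : KInjectiveResolution N) (i : ℤ) : ModuleCat.{u} A :=
  (RHom M ρ).homology i

/-- The cohomology of `N` is bounded: `N` is an object of `D^b(Mod A)`. -/
def HasBoundedCohomology {A : Type u} [CommRing A] (N : Complexes A) : Prop :=
  ∃ a b : ℤ, ∀ i : ℤ, (i < a ∨ b < i) → Subsingleton (N.homology i)

/-- All the cohomology modules of `N` are finitely generated: `N` is an object of
`D_f(Mod A)`. -/
def HasFGCohomology {A : Type u} [CommRing A] (N : Complexes A) : Prop :=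
  ∀ i : ℤ, Module.Finite A (N.homology i)

/-- Finite injective dimension: there is a natural number `i₀` such that `Ext^i_A(M, N) = 0` for
all `A`-modules `M` and all `i > i₀`. -/
def HasFiniteInjectiveDimension {A : Type u} [CommRing A] (N : Complexes A) : Prop :=
  ∃ (ρ : KInjectiveResolution N) (i₀ : ℕ), ∀ (M : ModuleCat.{u} A) (i : ℤ), (i₀ : ℤ) < i →
    Subsingleton (Ext (inDegreeZero A M) ρ i)

/-- The canonical morphism `A → Hom_A(I, I)` sending `a` to multiplication by `a` on `I`. -/
def homothety {A : Type u} [CommRing A] (I : Complexes A) :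
    inDegreeZero A (ModuleCat.of A A) ⟶ homComplex I I :=
  HomologicalComplex.mkHomFromSingle
    (ModuleCat.ofHom (LinearMap.toSpanSingleton A (Cochain I I 0) (Cochain.ofHom (𝟙 I))))
    (fun k _ => by
      ext
      change δ 0 k ((1 : A) • Cochain.ofHom (𝟙 I)) = 0
      rw [δ_smul, δ_ofHom, smul_zero])

/-- The canonical morphism `θ : A → RHom_A(R, R)` in `D(Mod A)` is an isomorphism. It is realized,
for a K-injective resolution `R → I` and the resulting isomorphism
`RHom_A(R, R) ≅ Hom_A(I, I)`, as the canonical morphism `A → Hom_A(I, I)`, which therefore has to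
be a quasi-isomorphism. Whether it is one does not depend on the resolution. -/
def CanonicalMorphismIsIso {A : Type u} [CommRing A] (R : Complexes A) : Prop :=
  ∃ ρ : KInjectiveResolution R, QuasiIso (homothety ρ.I)

/-- Dualizing complexes over the (noetherian) commutative ring `A`. -/
structure IsDualizing {A : Type u} [CommRing A] (R : Complexes A) : Prop where
  bounded : HasBoundedCohomology R
  fg : HasFGCohomology R
  finiteInjectiveDimension : HasFiniteInjectiveDimension R
  canonical : CanonicalMorphismIsIso R

instance extendScalars_additive {A : Type u} [CommRing A] (B : Type u) [CommRing B]
    [Algebra A B] : (ModuleCat.extendScalars.{u, u, u} (algebraMap A B)).Additive where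
  map_add {M N f g} := by
    let _ : Module A B := Module.compHom B (algebraMap A B)
    apply ModuleCat.hom_ext
    refine LinearMap.ext fun x => ?_
    exact LinearMap.congr_fun (LinearMap.lTensor_add B f.hom g.hom) x

/-- The complex `B ⊗_A R`. -/
def baseChange {A : Type u} [CommRing A] (B : Type u) [CommRing B] [Algebra A B]
    (R : Complexes A) : Complexes B :=
  ((ModuleCat.extendScalars.{u, u, u} (algebraMap A B)).mapHomologicalComplex
    (ComplexShape.up ℤ)).obj R

/-- Regular rings, in the sense of finite global cohomological dimension: there is a natural
number `d` such that `Ext^i_A(M, N) = 0` for all `A`-modules `M`, `N` and all `i > d`. -/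
def HasFiniteGlobalDimension (A : Type u) [CommRing A] : Prop :=
  ∃ d : ℕ, ∀ (M N : ModuleCat.{u} A) (i : ℕ), d < i → Subsingleton (Abelian.Ext.{u} M N i)

end DualizingComplex

end

-- Over a K-injective target, cocycles modulo coboundaries are morphisms in the derived category.
-- The condition that the multiples of a quasi-isomorphism `f : M ⟶ J` exhaust, without repetition,
-- the cohomology of `Hom(M, J)` therefore depends only on the class of `M` in the derived category.
-- For `f = 𝟙 I` it is the condition on the canonical morphism, so both source and resolution may be
-- chosen freely (`homothetyBijective_iff`, `canonicalMorphismIsIso_iff`).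
--
-- Localization. Finite injective dimension gives a quasi-isomorphism from `R` to a bounded complex
-- `J` of injectives (`exists_bounded_injective`), and noetherianity gives a quasi-isomorphism `F ⟶
-- J` with finitely generated terms (`exists_fg_quasiIso`). Localization is exact and preserves
-- injectives over a noetherian ring, so `B ⊗ J` is again a bounded injective resolution. Since the
-- `F^p` are finitely presented and `J` is bounded, cochains from `F` to `J` localize with a single
-- denominator, and so does the bijectivity of `A → H(Hom(F, J))`
-- (`homothetyBijective_baseChangeMap`).
--
-- Existence. Polynomial rings over a ring of finite global dimension have finite global dimension,
-- so an algebra of finite type over `A` is a quotient `C` of a noetherian ring `P` of finite global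
-- dimension. Let `J` be a bounded injective resolution of `P`. The biduality map `M → Hom(Hom(M,
-- J), J)` is a quasi-isomorphism for `M = P`, hence for every finitely generated `M`, by induction
-- on projective dimension. For `M = C`, adjunction turns this target into `Hom_C(D, D)` with `D =
-- Hom_P(C, J)`, so `D` is dualizing over `C`. A localization of `C` is then covered by the first
-- part.

universe w

noncomputable section

namespace DualizingComplex

/-! ### Cochains with K-injective target and morphisms in the derived category -/

section Derived

variable {C : Type*} [Category* C] [Abelian C]

/-- Every cocycle of degree `n` in the complex of morphisms from `M` to `N` is a coboundary. -/
def CocyclesAreCoboundaries (M N : CochainComplex C ℤ) (n : ℤ) : Prop :=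
  ∀ z : Cochain M N n, δ n (n + 1) z = 0 → ∃ β : Cochain M N (n - 1), δ (n - 1) n β = z

variable [HasDerivedCategory.{w} C]

/-- K-injectivity of `N` makes the passage from the homotopy category to the derived category
bijective on morphisms into `N`. -/
lemma Q_map_eq_zero_iff {M N : CochainComplex C ℤ} [N.IsKInjective] (f : M ⟶ N) :
    DerivedCategory.Q.map f = 0 ↔ (HomotopyCategory.quotient _ _).map f = 0 := by
  rw [← (IsKInjective.Qh_map_bijective _ N).injective.eq_iff, Functor.map_zero]
  rw [← cancel_mono ((DerivedCategory.quotientCompQhIso C).hom.app N),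
    DerivedCategory.quotientCompQhIso_hom_naturality, Limits.zero_comp,
    Preadditive.IsIso.comp_left_eq_zero]

lemma Q_map_surjective (M N : CochainComplex C ℤ) [N.IsKInjective] :
    Function.Surjective (fun f : M ⟶ N => DerivedCategory.Q.map f) := by
  intro φ
  obtain ⟨g, hg⟩ := (IsKInjective.Qh_map_bijective _ N).surjective
    ((DerivedCategory.quotientCompQhIso C).hom.app M ≫ φ ≫
      (DerivedCategory.quotientCompQhIso C).inv.app N)
  obtain ⟨f, rfl⟩ := (HomotopyCategory.quotient _ _).map_surjective g
  refine ⟨f, ?_⟩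
  have h := DerivedCategory.quotientCompQhIso_hom_naturality f
  rw [hg] at h
  simp only [Category.assoc, Iso.inv_hom_id_app, Category.comp_id] at h
  exact ((cancel_epi _).1 h).symm

/-- A zigzag `M ⟶ N ⟵ J` of quasi-isomorphisms, with `J` K-injective, can be straightened. -/
lemma exists_quasiIso_of_iso {M N : CochainComplex C ℤ} [N.IsKInjective]
    (e : DerivedCategory.Q.obj M ≅ DerivedCategory.Q.obj N) :
    ∃ f : M ⟶ N, QuasiIso f ∧ DerivedCategory.Q.map f = e.hom := by
  obtain ⟨f, hf⟩ := Q_map_surjective M N e.hom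
  refine ⟨f, ?_, hf⟩
  rw [← DerivedCategory.isIso_Q_map_iff_quasiIso]
  change DerivedCategory.Q.map f = e.hom at hf
  rw [hf]
  infer_instance

lemma Q_map_equivHomShift_symm_eq_zero_iff {M N : CochainComplex C ℤ} [N.IsKInjective] {n : ℤ}
    (z : Cocycle M N n) :
    DerivedCategory.Q.map (Cocycle.equivHomShift.symm z) = 0 ↔
      ∃ β : Cochain M N (n - 1), δ (n - 1) n β = z.1 := by
  rw [Q_map_eq_zero_iff, ← CohomologyClass.toHom_mk, CohomologyClass.toHom_mk_eq_zero_iff,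
    mem_coboundaries_iff _ (n - 1) (by simp)]

lemma Q_map_eq_zero_iff_exists_cochain {M N : CochainComplex C ℤ} [N.IsKInjective] (f : M ⟶ N) :
    DerivedCategory.Q.map f = 0 ↔ ∃ β : Cochain M N (-1), δ (-1) 0 β = Cochain.ofHom f := by
  rw [Q_map_eq_zero_iff, HomotopyCategory.quotient_map_eq_zero_iff]
  constructor
  · rintro ⟨h⟩
    obtain ⟨β, hβ⟩ := Cochain.equivHomotopy _ _ h
    exact ⟨β, by simpa using hβ.symm⟩
  · rintro ⟨β, hβ⟩
    exact ⟨(Cochain.equivHomotopy _ _).symm ⟨β, by simp [hβ]⟩⟩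

/-- A cocycle of degree `n` is a morphism `M ⟶ N⟦n⟧`, and it is a coboundary exactly when this
morphism is null-homotopic. The right-hand side can be transported along isomorphisms, which is how
resolutions are exchanged. -/
lemma cocyclesAreCoboundaries_iff (M N : CochainComplex C ℤ) [N.IsKInjective] (n : ℤ) :
    CocyclesAreCoboundaries M N n ↔
      ∀ φ : DerivedCategory.Q.obj M ⟶ (DerivedCategory.Q.obj N)⟦n⟧, φ = 0 := by
  have key : CocyclesAreCoboundaries M N n ↔
      ∀ φ : DerivedCategory.Q.obj M ⟶ DerivedCategory.Q.obj (N⟦n⟧), φ = 0 := by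
    constructor
    · intro h φ
      obtain ⟨f, rfl⟩ := Q_map_surjective M (N⟦n⟧) φ
      obtain ⟨β, hβ⟩ := h (Cocycle.equivHomShift f).1 (Cocycle.δ_eq_zero _ _)
      have := (Q_map_equivHomShift_symm_eq_zero_iff (Cocycle.equivHomShift f)).2 ⟨β, hβ⟩
      simpa using this
    · intro h z hz
      exact (Q_map_equivHomShift_symm_eq_zero_iff (Cocycle.mk z (n + 1) rfl hz)).1 (h _)
  rw [key]
  constructor
  · intro h φ
    have := h (φ ≫ ((DerivedCategory.Q.commShiftIso n).app N).inv)
    rwa [Preadditive.IsIso.comp_right_eq_zero] at this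
  · intro h φ
    have := h (φ ≫ ((DerivedCategory.Q.commShiftIso n).app N).hom)
    rwa [Preadditive.IsIso.comp_right_eq_zero] at this

end Derived

/-! ### Invariance of the homothety condition -/

section Homothety

variable (A : Type u) [CommRing A] {C : Type*} [Category* C] [Abelian C] [Linear A C]

/-- Multiples of `f : M ⟶ N` exhaust, without repetition, the cohomology of the complex of
morphisms from `M` to `N`. -/
structure HomothetyBijective {M N : CochainComplex C ℤ} (f : M ⟶ N) : Prop where
  injective : ∀ (a : A) (β : Cochain M N (-1)), δ (-1) 0 β = a • Cochain.ofHom f → a = 0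
  surjective : ∀ z : Cochain M N 0, δ 0 1 z = 0 →
    ∃ (a : A) (β : Cochain M N (-1)), z = a • Cochain.ofHom f + δ (-1) 0 β
  exact : ∀ n : ℤ, n ≠ 0 → CocyclesAreCoboundaries M N n

variable [HasDerivedCategory.{w} C]

/-- The homotheties of `X` exhaust, without repetition, the graded endomorphisms of `X`. -/
structure DerivedHomothetyBijective (X : DerivedCategory C) : Prop where
  injective : ∀ a : A, a • 𝟙 X = 0 → a = 0
  surjective : ∀ φ : X ⟶ X, ∃ a : A, φ = a • 𝟙 X
  shift : ∀ n : ℤ, n ≠ 0 → ∀ φ : X ⟶ X⟦n⟧, φ = 0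

variable {A}

/-- Composition with the invertible `Q.map f` identifies the graded endomorphisms of `Q M` with the
graded morphisms from `Q M` to `Q N`, and carries `a • 𝟙` to `a • f`. -/
lemma homothetyBijective_iff {M N : CochainComplex C ℤ} (f : M ⟶ N) [QuasiIso f]
    [N.IsKInjective] :
    HomothetyBijective A f ↔ DerivedHomothetyBijective A (DerivedCategory.Q.obj M) := by
  have key (φ : DerivedCategory.Q.obj M ⟶ DerivedCategory.Q.obj M) (a : A) :
      φ = a • 𝟙 _ ↔ φ ≫ DerivedCategory.Q.map f = DerivedCategory.Q.map (a • f) := by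
    rw [← cancel_mono (DerivedCategory.Q.map f), Functor.map_smul, Linear.smul_comp,
      Category.id_comp]
  have hof (a : A) : Cochain.ofHom (a • f) = a • Cochain.ofHom f := by
    ext p
    simp
  have hshift (n : ℤ) : CocyclesAreCoboundaries M N n ↔
      ∀ φ : DerivedCategory.Q.obj M ⟶ (DerivedCategory.Q.obj M)⟦n⟧, φ = 0 := by
    rw [cocyclesAreCoboundaries_iff]
    constructor
    · intro h φ
      have := h (φ ≫ (DerivedCategory.Q.map f)⟦n⟧')
      rwa [Preadditive.IsIso.comp_right_eq_zero] at this
    · intro h φ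
      have := h (φ ≫ (inv (DerivedCategory.Q.map f))⟦n⟧')
      rwa [Preadditive.IsIso.comp_right_eq_zero] at this
  have hinj (a : A) : a • 𝟙 (DerivedCategory.Q.obj M) = 0 ↔
      ∃ β : Cochain M N (-1), δ (-1) 0 β = a • Cochain.ofHom f := by
    rw [eq_comm, key, Limits.zero_comp, eq_comm, Q_map_eq_zero_iff_exists_cochain, hof]
  constructor
  · rintro ⟨h₁, h₂, h₃⟩
    refine ⟨fun a ha => ?_, fun φ => ?_, fun n hn => (hshift n).1 (h₃ n hn)⟩
    · obtain ⟨β, hβ⟩ := (hinj a).1 ha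
      exact h₁ a β hβ
    · obtain ⟨g, hg⟩ := Q_map_surjective M N (φ ≫ DerivedCategory.Q.map f)
      obtain ⟨a, β, h⟩ := h₂ (Cochain.ofHom g) (δ_ofHom g)
      refine ⟨a, (key _ _).2 ?_⟩
      rw [← hg, ← sub_eq_zero]
      dsimp only
      rw [← Functor.map_sub, Q_map_eq_zero_iff_exists_cochain]
      exact ⟨β, by rw [Cochain.ofHom_sub, hof, h]; abel⟩
  · rintro ⟨h₁, h₂, h₃⟩
    refine ⟨fun a β hβ => h₁ a ((hinj a).2 ⟨β, hβ⟩), fun z hz => ?_,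
      fun n hn => (hshift n).2 (h₃ n hn)⟩
    obtain ⟨g, hg⟩ := (Cocycle.equivHom M N).surjective (Cocycle.mk z 1 (by simp) hz)
    obtain ⟨a, ha⟩ := h₂ (DerivedCategory.Q.map g ≫ inv (DerivedCategory.Q.map f))
    rw [key, Category.assoc, IsIso.inv_hom_id, Category.comp_id, ← sub_eq_zero,
      ← Functor.map_sub, Q_map_eq_zero_iff_exists_cochain] at ha
    obtain ⟨β, hβ⟩ := ha
    refine ⟨a, β, ?_⟩
    have hz' : Cochain.ofHom g = z := congrArg Subtype.val hg
    rw [hβ, Cochain.ofHom_sub, hof, hz']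
    abel

lemma DerivedHomothetyBijective.of_iso {X Y : DerivedCategory C} (e : X ≅ Y)
    (h : DerivedHomothetyBijective A X) : DerivedHomothetyBijective A Y := by
  refine ⟨fun a ha => h.injective a ?_, fun φ => ?_, fun n hn φ => ?_⟩
  · have : e.hom ≫ (a • 𝟙 Y) ≫ e.inv = 0 := by simp [ha]
    simpa using this
  · obtain ⟨a, ha⟩ := h.surjective (e.hom ≫ φ ≫ e.inv)
    refine ⟨a, ?_⟩
    have : e.inv ≫ (e.hom ≫ φ ≫ e.inv) ≫ e.hom = φ := by simp
    rw [← this, ha]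
    simp
  · have := h.shift n hn (e.hom ≫ φ ≫ e.inv⟦n⟧')
    rwa [Preadditive.IsIso.comp_left_eq_zero, Preadditive.IsIso.comp_right_eq_zero] at this

end Homothety

/-! ### Quasi-isomorphisms and Ext in terms of elements -/

section Elements

variable {A : Type u} [CommRing A]

/-- The two clauses are injectivity and surjectivity of the map induced on cycles modulo boundaries.
-/
lemma shortComplex_quasiIso_iff {S T : ShortComplex (ModuleCat.{u} A)} (φ : S ⟶ T) :
    ShortComplex.QuasiIso φ ↔
      (∀ x : S.X₂, S.g x = 0 → (∃ y : T.X₁, T.f y = φ.τ₂ x) → ∃ x' : S.X₁, S.f x' = x) ∧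
      (∀ y : T.X₂, T.g y = 0 → ∃ x : S.X₂, S.g x = 0 ∧ ∃ y' : T.X₁, y = φ.τ₂ x + T.f y') := by
  have h₁ (x : S.X₁) : φ.τ₂ (S.f x) = T.f (φ.τ₁ x) := (ConcreteCategory.congr_hom φ.comm₁₂ x).symm
  have h₂ (x : S.X₂) : φ.τ₃ (S.g x) = T.g (φ.τ₂ x) := (ConcreteCategory.congr_hom φ.comm₂₃ x).symm
  let k : LinearMap.ker S.g.hom →ₗ[A] LinearMap.ker T.g.hom :=
    φ.τ₂.hom.restrict (fun x hx => by
      rw [LinearMap.mem_ker] at hx ⊢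
      exact (h₂ x).symm.trans ((congrArg φ.τ₃ hx).trans (map_zero φ.τ₃.hom)))
  have hk : LinearMap.range S.moduleCatToCycles ≤
      (LinearMap.range T.moduleCatToCycles).comap k := by
    rintro _ ⟨x, rfl⟩
    exact ⟨φ.τ₁ x, Subtype.ext (h₁ x).symm⟩
  let γ : ShortComplex.LeftHomologyMapData φ S.moduleCatLeftHomologyData
      T.moduleCatLeftHomologyData :=
    { φK := ModuleCat.ofHom k
      φH := ModuleCat.ofHom (Submodule.mapQ _ _ k hk)
      commi := rfl
      commf' := by
        ext x
        exact Subtype.ext (h₁ x)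
      commπ := rfl }
  rw [γ.quasiIso_iff, ConcreteCategory.isIso_iff_bijective]
  refine and_congr ?_ ?_
  · change Function.Injective (Submodule.mapQ _ _ k hk) ↔ _
    rw [injective_iff_map_eq_zero]
    constructor
    · rintro h x hx ⟨y, hy⟩
      have := h (Submodule.Quotient.mk ⟨x, hx⟩) (by
        rw [Submodule.mapQ_apply, Submodule.Quotient.mk_eq_zero]
        exact ⟨y, Subtype.ext hy⟩)
      rw [Submodule.Quotient.mk_eq_zero] at this
      obtain ⟨x', hx'⟩ := this
      exact ⟨x', congrArg Subtype.val hx'⟩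
    · intro h x hx
      obtain ⟨⟨x, hx'⟩, rfl⟩ := Submodule.Quotient.mk_surjective _ x
      rw [Submodule.mapQ_apply, Submodule.Quotient.mk_eq_zero] at hx
      obtain ⟨y, hy⟩ := hx
      obtain ⟨x', hx''⟩ := h x hx' ⟨y, congrArg Subtype.val hy⟩
      rw [Submodule.Quotient.mk_eq_zero]
      exact ⟨x', Subtype.ext hx''⟩
  · change Function.Surjective (Submodule.mapQ _ _ k hk) ↔ _
    constructor
    · intro h y hy
      obtain ⟨x, hx⟩ := h (Submodule.Quotient.mk ⟨y, hy⟩)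
      obtain ⟨⟨x, hx'⟩, rfl⟩ := Submodule.Quotient.mk_surjective _ x
      rw [Submodule.mapQ_apply, eq_comm, Submodule.Quotient.eq] at hx
      obtain ⟨y', hy'⟩ := hx
      refine ⟨x, hx', y', ?_⟩
      have : T.f y' = y - φ.τ₂ x := congrArg Subtype.val hy'
      rw [this]
      abel
    · intro h y
      obtain ⟨⟨y, hy⟩, rfl⟩ := Submodule.Quotient.mk_surjective _ y
      obtain ⟨x, hx, y', hy'⟩ := h y hy
      refine ⟨Submodule.Quotient.mk ⟨x, hx⟩, ?_⟩
      rw [Submodule.mapQ_apply, eq_comm, Submodule.Quotient.eq]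
      refine ⟨y', Subtype.ext ?_⟩
      change T.f y' = y - φ.τ₂ x
      rw [hy']
      abel

lemma quasiIsoAt_iff_elements {K L : Complexes A} (f : K ⟶ L) (i j k : ℤ) (hij : i + 1 = j)
    (hjk : j + 1 = k) :
    QuasiIsoAt f j ↔
      (∀ x : K.X j, K.d j k x = 0 → (∃ y, L.d i j y = f.f j x) → ∃ x', K.d i j x' = x) ∧
      (∀ y : L.X j, L.d j k y = 0 → ∃ x, K.d j k x = 0 ∧ ∃ y', y = f.f j x + L.d i j y') := by
  rw [quasiIsoAt_iff' f i j k (by simp [← hij]) (by simp [hjk]), shortComplex_quasiIso_iff]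
  rfl

lemma exactAt_iff_elements (K : Complexes A) (i j k : ℤ) (hij : i + 1 = j) (hjk : j + 1 = k) :
    K.ExactAt j ↔ ∀ x : K.X j, K.d j k x = 0 → ∃ x', K.d i j x' = x := by
  rw [K.exactAt_iff' i j k (by simp [← hij]) (by simp [hjk]), ShortComplex.moduleCat_exact_iff]
  rfl

lemma subsingleton_homology_iff (K : Complexes A) (n : ℤ) :
    Subsingleton (K.homology n) ↔ K.ExactAt n := by
  rw [HomologicalComplex.exactAt_iff_isZero_homology, ModuleCat.isZero_iff_subsingleton]

lemma subsingleton_Ext_iff (M : Complexes A) {N : Complexes A} (ρ : KInjectiveResolution N)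
    (n : ℤ) : Subsingleton (Ext M ρ n) ↔ CocyclesAreCoboundaries M ρ.I n := by
  rw [subsingleton_homology_iff, exactAt_iff_elements _ (n - 1) n (n + 1) (by simp) rfl]
  rfl

/-- A criterion for a morphism from a module, in degree zero, to be a quasi-isomorphism. -/
lemma quasiIso_mkHomFromSingle_iff {M : ModuleCat.{u} A} {L : Complexes A} (g : M ⟶ L.X 0)
    (hg : ∀ k : ℤ, (ComplexShape.up ℤ).Rel 0 k → g ≫ L.d 0 k = 0) :
    QuasiIso (HomologicalComplex.mkHomFromSingle g hg) ↔
      (∀ (m : M) (y : L.X (-1)), L.d (-1) 0 y = g m → m = 0) ∧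
      (∀ z : L.X 0, L.d 0 1 z = 0 → ∃ m y, z = g m + L.d (-1) 0 y) ∧
      (∀ n : ℤ, n ≠ 0 → L.ExactAt n) := by
  have h₀ : QuasiIsoAt (HomologicalComplex.mkHomFromSingle g hg) 0 ↔
      (∀ (m : M) (y : L.X (-1)), L.d (-1) 0 y = g m → m = 0) ∧
      (∀ z : L.X 0, L.d 0 1 z = 0 → ∃ m y, z = g m + L.d (-1) 0 y) := by
    have hS : ∀ x : (inDegreeZero A M).X 0, ∃ m : M,
        x = (HomologicalComplex.singleObjXSelf (ComplexShape.up ℤ) 0 M).inv m := fun x =>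
      ⟨(HomologicalComplex.singleObjXSelf (ComplexShape.up ℤ) 0 M).hom x, by simp⟩
    have hf : ∀ m : M, (HomologicalComplex.mkHomFromSingle g hg).f 0
        ((HomologicalComplex.singleObjXSelf (ComplexShape.up ℤ) 0 M).inv m) = g m := by
      intro m
      rw [HomologicalComplex.mkHomFromSingle_f]
      simp
    have hd (i j : ℤ) : (inDegreeZero A M).d i j = 0 := by
      simp
    rw [quasiIsoAt_iff_elements _ (-1) 0 1 (by simp) (by simp)]
    simp only [hd]
    refine and_congr ⟨fun h m y hy => ?_, fun h x _ hx => ?_⟩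
      ⟨fun h z hz => ?_, fun h z hz => ?_⟩
    · obtain ⟨x', hx'⟩ := h _ rfl ⟨y, hy.trans (hf m).symm⟩
      have h0 := congrArg (HomologicalComplex.singleObjXSelf (ComplexShape.up ℤ) 0 M).hom hx'
      have h1 : ((0 : (inDegreeZero A M).X (-1) ⟶ (inDegreeZero A M).X 0)) x' = 0 := rfl
      rw [h1, map_zero] at h0
      simpa using h0.symm
    · obtain ⟨m, hm⟩ := hS x
      obtain ⟨y, hy⟩ := hx
      rw [hm] at hy ⊢
      rw [h m y (hy.trans (hf m)), map_zero]
      exact ⟨0, rfl⟩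
    · obtain ⟨x, _, y, hy⟩ := h z hz
      obtain ⟨m, hm⟩ := hS x
      exact ⟨m, y, by rw [hy, hm, hf]⟩
    · obtain ⟨m, y, hy⟩ := h z hz
      exact ⟨_, rfl, y, by rw [hy, hf]⟩
  have hn (n : ℤ) (hn : n ≠ 0) : QuasiIsoAt (HomologicalComplex.mkHomFromSingle g hg) n ↔
      L.ExactAt n :=
    quasiIsoAt_iff_exactAt _ _ (HomologicalComplex.exactAt_single_obj _ _ _ _ hn)
  rw [quasiIso_iff, ← and_assoc, ← h₀]
  constructor
  · exact fun h => ⟨h 0, fun n hn0 => (hn n hn0).1 (h n)⟩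
  · rintro ⟨h, h'⟩ n
    by_cases hn0 : n = 0
    · subst hn0
      exact h
    · exact (hn n hn0).2 (h' n hn0)

lemma quasiIso_homothety_iff (I : Complexes A) :
    QuasiIso (homothety I) ↔ HomothetyBijective A (𝟙 I) := by
  refine (quasiIso_mkHomFromSingle_iff _ _).trans ?_
  constructor
  · rintro ⟨h₁, h₂, h₃⟩
    exact ⟨h₁, h₂, fun n hn => (exactAt_iff_elements _ (n - 1) n (n + 1) (by simp) rfl).1
      (h₃ n hn)⟩
  · rintro ⟨h₁, h₂, h₃⟩
    exact ⟨h₁, h₂, fun n hn => (exactAt_iff_elements _ (n - 1) n (n + 1) (by simp) rfl).2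
      (h₃ n hn)⟩

-- Both conditions express the same property of `Q R`, since a resolution of `R` becomes an
-- isomorphism there.
attribute [local instance] HasDerivedCategory.standard in
lemma canonicalMorphismIsIso_iff (R : Complexes A) {J : Complexes A} [J.IsKInjective]
    (f : R ⟶ J) [QuasiIso f] : CanonicalMorphismIsIso R ↔ HomothetyBijective A f := by
  constructor
  · rintro ⟨ρ, hρ⟩
    have := ρ.isKInjective
    have := ρ.quasiIso
    rw [quasiIso_homothety_iff, homothetyBijective_iff] at hρ
    rw [homothetyBijective_iff]
    exact hρ.of_iso (asIso (DerivedCategory.Q.map ρ.ι)).symm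
  · intro h
    refine ⟨⟨J, f, inferInstance, inferInstance⟩, ?_⟩
    rw [homothetyBijective_iff] at h
    rw [quasiIso_homothety_iff, homothetyBijective_iff]
    exact h.of_iso (asIso (DerivedCategory.Q.map f))

attribute [local instance] HasDerivedCategory.standard in
lemma HomothetyBijective.of_quasiIso {M M' J J' : Complexes A} [J.IsKInjective]
    [J'.IsKInjective] {f : M ⟶ J} [QuasiIso f] (h : HomothetyBijective A f) (g : M' ⟶ J')
    [QuasiIso g] (e : DerivedCategory.Q.obj J ≅ DerivedCategory.Q.obj J') :
    HomothetyBijective A g := by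
  rw [homothetyBijective_iff] at h ⊢
  exact h.of_iso (asIso (DerivedCategory.Q.map f) ≪≫ e ≪≫ (asIso (DerivedCategory.Q.map g)).symm)

/-- A complex quasi-isomorphic to a bounded complex of injective modules has finite injective
dimension. -/
lemma hasFiniteInjectiveDimension_of_quasiIso {R J : Complexes A} [J.IsKInjective] (b : ℤ)
    [J.IsStrictlyLE b] (f : R ⟶ J) [QuasiIso f] : HasFiniteInjectiveDimension R := by
  refine ⟨⟨J, f, inferInstance, inferInstance⟩, b.toNat, fun M i hi => ?_⟩
  rw [subsingleton_Ext_iff]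
  -- The cochain `z` is itself zero: its source lives in degree `0`, so its only possible component
  -- lands in `J^i`, and `i > b`.
  intro z _
  refine ⟨0, ?_⟩
  rw [δ_zero]
  refine Cochain.ext _ _ fun p q hpq => ?_
  by_cases hp : p = 0
  · exact (J.isZero_of_isStrictlyLE b q (by lia)).eq_of_tgt _ _
  · exact (HomologicalComplex.isZero_single_obj_X (ComplexShape.up ℤ) 0 M p hp).eq_of_src _ _

end Elements

/-! ### Bounded injective resolutions from finite injective dimension -/

section BoundedInjective

variable {C : Type*} [Category* C] [Abelian C]

/-- If `Ext^{m+1}(Z^{m+1}, J)` vanishes, then `Z^m` is a direct summand of `J^m`. -/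
lemma injective_cycles (J : CochainComplex C ℤ) (m : ℤ) [Injective (J.X m)]
    (h : CocyclesAreCoboundaries
      ((CochainComplex.singleFunctor C 0).obj (J.cycles (m + 1))) J (m + 1)) :
    Injective (J.cycles m) := by
  -- The inclusion of `Z^{m+1}` in `J^{m+1}` is a cocycle of degree `m + 1`; a cochain that bounds
  -- it is a lift `s` of the inclusion through the differential.
  obtain ⟨s, hs⟩ : ∃ s : J.cycles (m + 1) ⟶ J.X m, s ≫ J.d m (m + 1) = J.iCycles (m + 1) := by
    obtain ⟨β, hβ⟩ := h (Cochain.fromSingleMk (J.iCycles (m + 1)) (zero_add (m + 1))) (by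
      rw [Cochain.δ_fromSingleMk _ _ _ _ (zero_add _), J.iCycles_d, Cochain.fromSingleMk_zero])
    obtain ⟨s, rfl⟩ := Cochain.fromSingleMk_surjective β m (by lia)
    rw [Cochain.δ_fromSingleMk _ _ _ _ (zero_add _)] at hβ
    exact ⟨s, (Cochain.fromSingleEquiv (zero_add (m + 1))).symm.injective hβ⟩
  have ht : J.toCycles m (m + 1) ≫ J.iCycles (m + 1) = J.d m (m + 1) := J.toCycles_i _ _
  -- `id - s ∘ d` takes values in cycles and is the identity on them.
  let r : J.X m ⟶ J.cycles m := J.liftCycles (𝟙 _ - J.toCycles m (m + 1) ≫ s) (m + 1) (by simp) (by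
    rw [Preadditive.sub_comp, Category.assoc, hs, ht, Category.id_comp, sub_self])
  refine Retract.injective (Y := J.X m) ⟨J.iCycles m, r, ?_⟩
  rw [← cancel_mono (J.iCycles m), Category.assoc, J.liftCycles_i, Preadditive.comp_sub,
    Category.comp_id, Category.id_comp]
  have : J.iCycles m ≫ J.toCycles m (m + 1) = 0 := by
    rw [← cancel_mono (J.iCycles (m + 1)), Category.assoc, ht, J.iCycles_d, Limits.zero_comp]
  rw [reassoc_of% this, Limits.zero_comp, sub_zero]

lemma injective_truncLE_X (J : CochainComplex C ℤ) (m : ℤ) [∀ n, Injective (J.X n)]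
    [Injective (J.cycles m)] (n : ℤ) : Injective ((J.truncLE m).X n) := by
  by_cases hn : m < n
  · exact ((J.truncLE m).isZero_of_isStrictlyLE m n hn).injective
  · obtain ⟨k, rfl⟩ := Int.le.dest (not_lt.1 hn)
    obtain rfl | hk := eq_or_ne k 0
    · have e := J.truncLEXIsoCycles (n + (0 : ℕ))
      rw [Nat.cast_zero, add_zero] at *
      exact Injective.of_iso e.symm inferInstance
    · exact Injective.of_iso (J.truncLEXIso (n + k) n (by lia)).symm inferInstance

variable [HasDerivedCategory.{w} C] [EnoughInjectives C]

/-- A complex with cohomology bounded below and of finite injective dimension is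
quasi-isomorphic to a bounded complex of injective objects. -/
lemma exists_bounded_injective (N : CochainComplex C ℤ) (a : ℤ) [N.IsGE a] (i₀ : ℤ)
    (h : ∀ (M : C) (i : ℤ), i₀ < i → ∀ φ : DerivedCategory.Q.obj
      ((HomologicalComplex.single C (ComplexShape.up ℤ) 0).obj M) ⟶
        (DerivedCategory.Q.obj N)⟦i⟧, φ = 0)
    (hN : ∀ i, i₀ < i → N.ExactAt i) :
    ∃ (J : CochainComplex C ℤ) (f : N ⟶ J), QuasiIso f ∧ (∀ n, Injective (J.X n)) ∧
      J.IsStrictlyGE a ∧ J.IsStrictlyLE i₀ := by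
  obtain ⟨J, g, hg, hJ, hJa⟩ :=
    CochainComplex.Plus.modelCategoryQuillen.exists_quasiIso_injective (N.truncGE a) a
  have := isKInjective_of_injective J a
  let g' : N ⟶ J := N.πTruncGE a ≫ g
  have hg' : QuasiIso g' := inferInstance
  -- The truncation of `J` in degrees at most `i₀` replaces `J^{i₀}` by `Z^{i₀}`, so this is the
  -- only term whose injectivity is in doubt.
  have hcyc : Injective (J.cycles i₀) := injective_cycles J i₀ (by
    rw [cocyclesAreCoboundaries_iff]
    intro φ
    exact (Preadditive.IsIso.comp_right_eq_zero φ ((inv (DerivedCategory.Q.map g'))⟦i₀ + 1⟧')).1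
      (h _ (i₀ + 1) (by lia) _))
  have hJ' := injective_truncLE_X J i₀
  have hle : J.IsLE i₀ := by
    rw [isLE_iff]
    intro i hi
    exact (exactAt_iff_of_quasiIsoAt g' i).1 (hN i hi)
  have := isKInjective_of_injective (J.truncLE i₀) a
  -- The truncation maps to `J`, in the wrong direction; since it is K-injective, the zigzag from
  -- `N` can be replaced by one morphism.
  obtain ⟨f, hf, -⟩ := exists_quasiIso_of_iso
    (asIso (DerivedCategory.Q.map g') ≪≫ (asIso (DerivedCategory.Q.map (J.ιTruncLE i₀))).symm)
  exact ⟨_, f, hf, hJ', inferInstance, inferInstance⟩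

end BoundedInjective

attribute [local instance] HasDerivedCategory.standard in
lemma exists_bounded_injective_of_hasFiniteInjectiveDimension {A : Type u} [CommRing A]
    (R : Complexes A) (hb : HasBoundedCohomology R) (hR : HasFiniteInjectiveDimension R) :
    ∃ (J : Complexes A) (f : R ⟶ J) (a b : ℤ), QuasiIso f ∧ (∀ n, Injective (J.X n)) ∧
      J.IsStrictlyGE a ∧ J.IsStrictlyLE b := by
  obtain ⟨a, b, hab⟩ := hb
  obtain ⟨ρ, i₀, hρ⟩ := hR
  have := ρ.isKInjective
  have := ρ.quasiIso
  have : R.IsGE a := by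
    rw [isGE_iff]
    intro i hi
    exact (subsingleton_homology_iff R i).1 (hab i (Or.inl hi))
  obtain ⟨J, f, hf, hJ, h₁, h₂⟩ := exists_bounded_injective R a (max b i₀) (fun M i hi φ => by
      have h := hρ M i (by lia)
      rw [subsingleton_Ext_iff, cocyclesAreCoboundaries_iff] at h
      have := h (φ ≫ (DerivedCategory.Q.map ρ.ι)⟦i⟧')
      rwa [Preadditive.IsIso.comp_right_eq_zero] at this)
    (fun i hi => (subsingleton_homology_iff R i).1 (hab i (Or.inr (by lia))))
  exact ⟨J, f, a, _, hf, hJ, h₁, h₂⟩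

/-! ### Models with finitely generated terms -/

section Subcomplex

variable {A : Type u} [CommRing A]

/-- The subcomplex of `J` with terms `F n`. -/
def subcomplex (J : Complexes A) (F : ∀ n : ℤ, Submodule A (J.X n))
    (hF : ∀ i j, F i ≤ (F j).comap (J.d i j).hom) : Complexes A where
  X n := ModuleCat.of A (F n)
  d i j := ModuleCat.ofHom ((J.d i j).hom.restrict (hF i j))
  shape i j hij := by
    refine ModuleCat.hom_ext (LinearMap.ext fun x => Subtype.ext ?_)
    exact ConcreteCategory.congr_hom (J.shape i j hij) x.1
  d_comp_d' i j k _ _ := by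
    refine ModuleCat.hom_ext (LinearMap.ext fun x => Subtype.ext ?_)
    exact ConcreteCategory.congr_hom (J.d_comp_d i j k) x.1

/-- The inclusion of a subcomplex. -/
def subcomplexι (J : Complexes A) (F : ∀ n : ℤ, Submodule A (J.X n))
    (hF : ∀ i j, F i ≤ (F j).comap (J.d i j).hom) : subcomplex J F hF ⟶ J where
  f n := ModuleCat.ofHom (F n).subtype
  comm' _ _ _ := rfl

lemma exists_fg_map_eq {M N : Type*} [AddCommGroup M] [Module A M] [AddCommGroup N] [Module A N]
    (f : M →ₗ[A] N) (P : Submodule A N) (hP : P.FG) (hP' : P ≤ LinearMap.range f) :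
    ∃ L : Submodule A M, L.FG ∧ L.map f = P := by
  classical
  obtain ⟨s, rfl⟩ := hP
  have hs : ∀ x : s, ∃ y, f y = x := fun x => hP' (Submodule.subset_span x.2)
  choose g hg using hs
  refine ⟨Submodule.span A (Set.range g), Submodule.fg_span (Set.finite_range g), ?_⟩
  rw [Submodule.map_span, ← Set.range_comp]
  congr 1
  ext x
  simp [hg]

lemma exists_fg_cocycles (J : Complexes A) (i j k : ℤ) (hij : i + 1 = j) (hjk : j + 1 = k)
    [Module.Finite A (J.homology j)] :
    ∃ L : Submodule A (J.X j), L.FG ∧ L ≤ LinearMap.ker (J.d j k).hom ∧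
      ∀ z, J.d j k z = 0 → ∃ x ∈ L, ∃ y, z = x + J.d i j y := by
  let e : J.homology j ≅ (J.sc' i j k).homology :=
    ShortComplex.homologyMapIso (J.isoSc' i j k (by simp [← hij]) (by simp [hjk]))
  let S := J.sc' i j k
  have hfin : Module.Finite A
      (LinearMap.ker S.g.hom ⧸ LinearMap.range S.moduleCatToCycles) :=
    Module.Finite.equiv (e ≪≫ S.moduleCatHomologyIso).toLinearEquiv
  obtain ⟨L, hL, hL'⟩ := exists_fg_map_eq (LinearMap.range S.moduleCatToCycles).mkQ ⊤ hfin.1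
    (by simp)
  refine ⟨L.map (LinearMap.ker S.g.hom).subtype, hL.map _, ?_, fun z hz => ?_⟩
  · rintro _ ⟨x, _, rfl⟩
    exact x.2
  · have hz' : (LinearMap.range S.moduleCatToCycles).mkQ ⟨z, hz⟩ ∈ L.map
      (LinearMap.range S.moduleCatToCycles).mkQ := hL' ▸ Submodule.mem_top
    obtain ⟨x, hx, hx'⟩ := hz'
    rw [eq_comm, Submodule.mkQ_apply, Submodule.mkQ_apply, Submodule.Quotient.eq] at hx'
    obtain ⟨y, hy⟩ := hx'
    let x₀ : J.X j := x.1
    refine ⟨x₀, ⟨x, hx, rfl⟩, y, ?_⟩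
    have : J.d i j y = z - x₀ := congrArg Subtype.val hy
    rw [this]
    abel

variable [IsNoetherianRing A]

/-- One step of a descending construction: `L` is generated by lifts of generators of `G ∩ im d`,
finitely generated by noetherianity, and by cocycles representing generators of the cohomology. The
hypothesis `G.FG` stands inside the existential so that `choose` yields a function defined on all
`G`. -/
lemma exists_fg_extension (J : Complexes A) (hJ : HasFGCohomology J) (n : ℤ)
    (G : Submodule A (J.X (n + 1))) :
    ∃ L : Submodule A (J.X n), G.FG → L.FG ∧
      L.map (J.d n (n + 1)).hom = G ⊓ LinearMap.range (J.d n (n + 1)).hom ∧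
      ∀ z, J.d n (n + 1) z = 0 → ∃ x ∈ L, J.d n (n + 1) x = 0 ∧
        ∃ y, z = x + J.d (n - 1) n y := by
  by_cases hG : G.FG
  · have := hJ n
    obtain ⟨L₁, h₁, h₁', h₁''⟩ := exists_fg_cocycles J (n - 1) n (n + 1) (by simp) rfl
    have hfg : (G ⊓ LinearMap.range (J.d n (n + 1)).hom).FG := by
      have : Module.Finite A G := Module.Finite.of_fg hG
      have : IsNoetherian A G := inferInstance
      rw [isNoetherian_submodule] at this
      exact this _ inf_le_left
    obtain ⟨L₂, h₂, h₂'⟩ := exists_fg_map_eq _ _ hfg inf_le_right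
    refine ⟨L₁ ⊔ L₂, fun _ => ⟨h₁.sup h₂, ?_, fun z hz => ?_⟩⟩
    · rw [Submodule.map_sup, h₂', LinearMap.le_ker_iff_map.1 h₁', bot_sup_eq]
    · obtain ⟨x, hx, y, hy⟩ := h₁'' z hz
      exact ⟨x, Submodule.mem_sup_left hx, h₁' hx, y, hy⟩
  · exact ⟨⊥, fun h => (hG h).elim⟩

/-- A bounded above complex with finitely generated cohomology, over a noetherian ring, is
quasi-isomorphic to a subcomplex with finitely generated terms. -/
lemma exists_fg_quasiIso (J : Complexes A) (hJ : HasFGCohomology J) (b : ℤ) [J.IsStrictlyLE b] :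
    ∃ (F : Complexes A) (f : F ⟶ J), QuasiIso f ∧ ∀ n, Module.Finite A (F.X n) := by
  choose step hstep using exists_fg_extension J hJ
  -- `G k n` is the outcome of `k` steps arriving in degree `n`, starting from zero in degree `n +
  -- k`. Taking `k = b + 1 - n` makes all degrees start from the same place, `b + 1`, where `J`
  -- vanishes.
  let G : ℕ → ∀ n : ℤ, Submodule A (J.X n) := fun k =>
    Nat.rec (fun _ => ⊥) (fun _ g n => step n (g (n + 1))) k
  let F : ∀ n : ℤ, Submodule A (J.X n) := fun n => G (b + 1 - n).toNat n
  have hF₀ (n : ℤ) (hn : b < n) : F n = ⊥ := by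
    have : (b + 1 - n).toNat = 0 := by lia
    change G (b + 1 - n).toNat n = ⊥
    rw [this]
    rfl
  have hF (n : ℤ) (hn : n ≤ b) : F n = step n (F (n + 1)) := by
    have : (b + 1 - n).toNat = (b + 1 - (n + 1)).toNat + 1 := by lia
    change G (b + 1 - n).toNat n = _
    rw [this]
  have hJ₀ (n : ℤ) (hn : b < n) : Subsingleton (J.X n) :=
    ModuleCat.isZero_iff_subsingleton.1 (J.isZero_of_isStrictlyLE b n hn)
  have hfg (k : ℕ) : ∀ n : ℤ, b < n + k → (F n).FG := by
    induction k with
    | zero =>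
      intro n hn
      rw [hF₀ n (by simpa using hn)]
      exact Submodule.fg_bot
    | succ k ih =>
      intro n hn
      by_cases hn' : n ≤ b
      · rw [hF n hn']
        exact (hstep n _ (ih (n + 1) (by push_cast at hn; lia))).1
      · rw [hF₀ n (not_le.1 hn')]
        exact Submodule.fg_bot
  have hfg' (n : ℤ) : (F n).FG := hfg (b + 1 - n).toNat n (by lia)
  have hmap (n m : ℤ) (hm : n + 1 = m) : (F n).map (J.d n m).hom =
      F m ⊓ LinearMap.range (J.d n m).hom := by
    subst hm
    by_cases hn : n ≤ b
    · rw [hF n hn]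
      exact (hstep n _ (hfg' _)).2.1
    · have := hJ₀ (n + 1) (by lia)
      exact Subsingleton.elim _ _
  have hcoc (n : ℤ) (z : J.X n) (hz : J.d n (n + 1) z = 0) : ∃ x ∈ F n,
      J.d n (n + 1) x = 0 ∧ ∃ y, z = x + J.d (n - 1) n y := by
    by_cases hn : n ≤ b
    · rw [hF n hn]
      exact (hstep n _ (hfg' _)).2.2 z hz
    · have := hJ₀ n (by lia)
      exact ⟨0, zero_mem _, map_zero _, 0, Subsingleton.elim _ _⟩
  have hd (i j : ℤ) : F i ≤ (F j).comap (J.d i j).hom := by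
    by_cases hij : i + 1 = j
    · subst hij
      rw [← Submodule.map_le_iff_le_comap, hmap _ _ rfl]
      exact inf_le_left
    · intro x _
      rw [Submodule.mem_comap, J.shape i j hij]
      exact zero_mem _
  refine ⟨subcomplex J F hd, subcomplexι J F hd, ⟨fun n => ?_⟩,
    fun n => Module.Finite.of_fg (hfg' n)⟩
  rw [quasiIsoAt_iff_elements _ (n - 1) n (n + 1) (by simp) rfl]
  refine ⟨fun x hx ⟨y, hy⟩ => ?_, fun z hz => ?_⟩
  -- Injectivity on cohomology: by `hmap`, a boundary of `J` that lies in `F n` is already a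
  -- boundary of the subcomplex.
  · have : x.1 ∈ (F (n - 1)).map (J.d (n - 1) n).hom := by
      rw [hmap _ _ (by simp)]
      exact ⟨x.2, y, hy⟩
    obtain ⟨x', hx', h⟩ := this
    exact ⟨⟨x', hx'⟩, Subtype.ext h⟩
  · obtain ⟨x, hx, hx', y, hy⟩ := hcoc n z hz
    exact ⟨⟨x, hx⟩, Subtype.ext hx', y, hy⟩

end Subcomplex

/-! ### Localization of modules and of their morphisms -/

section LocalizationModules

open ModuleCat

variable {A B : Type u} [CommRing A] [CommRing B]

lemma isLocalizedModule_unit_of_toAlgebra (f : A →+* B) (S : Submonoid A)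
    (h : @IsLocalization A _ S B _ f.toAlgebra) (M : ModuleCat.{u} A) :
    IsLocalizedModule S ((extendRestrictScalarsAdj f).unit.app M).hom := by
  let _ : Algebra A B := f.toAlgebra
  have h₁ : IsLocalizedModule S (TensorProduct.mk A B M 1) :=
    (isLocalizedModule_iff_isBaseChange S B _).2 (TensorProduct.isBaseChange A M B)
  exact h₁

lemma finite_extendScalars_obj (f : A →+* B) (M : ModuleCat.{u} A) [Module.Finite A M] :
    Module.Finite B ((extendScalars.{u, u, u} f).obj M) := by
  let _ : Algebra A B := f.toAlgebra
  exact (inferInstance : Module.Finite B (TensorProduct A B M))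

lemma extendScalars_map_smul (f : A →+* B) {M N : ModuleCat.{u} A} (g : M ⟶ N) (a : A) :
    (extendScalars.{u, u, u} f).map (a • g) = f a • (extendScalars.{u, u, u} f).map g := by
  let _ : Algebra A B := f.toAlgebra
  refine ModuleCat.hom_ext (LinearMap.ext fun x => ?_)
  change LinearMap.lTensor B (a • g.hom) x = a • LinearMap.lTensor B g.hom x
  rw [LinearMap.lTensor_smul]
  rfl

variable [Algebra A B]

/-- `extendScalars` is built on the algebra structure `(algebraMap A B).toAlgebra`, which has to be
identified with the given one. -/
lemma isLocalization_toAlgebra (S : Submonoid A) [IsLocalization S B] :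
    @IsLocalization A _ S B _ (algebraMap A B).toAlgebra := by
  convert ‹IsLocalization S B›
  exact Algebra.algebra_ext _ _ fun _ => rfl

instance isLocalizedModule_unit (S : Submonoid A) [IsLocalization S B] (M : ModuleCat.{u} A) :
    IsLocalizedModule S ((extendRestrictScalarsAdj (algebraMap A B)).unit.app M).hom :=
  isLocalizedModule_unit_of_toAlgebra _ S (isLocalization_toAlgebra S) M

lemma preservesFiniteLimits_extendScalars_of_isLocalization (S : Submonoid A)
    [IsLocalization S B] :
    Limits.PreservesFiniteLimits (extendScalars.{u, u, u} (algebraMap A B)) :=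
  preservesFiniteLimits_extendScalars_of_flat
    (RingHom.flat_algebraMap_iff.2 (IsLocalization.flat B S))

lemma injective_of_isLocalizedModule_restrictScalars (S : Submonoid A) [IsLocalization S B]
    [IsNoetherianRing A] (M : ModuleCat.{u} A) [Injective M] (N : ModuleCat.{u} B)
    (g : M →ₗ[A] (restrictScalars (algebraMap A B)).obj N) [hg : IsLocalizedModule S g] :
    Injective N := by
  have h₁ : Module.Injective A M := Module.injective_module_of_injective_object A M
  rw [← Module.injective_iff_injective_object]
  let _ : Module A N := inferInstanceAs (Module A ((restrictScalars (algebraMap A B)).obj N))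
  have : IsScalarTower A B N :=
    ⟨fun a b x => by
      rw [Algebra.smul_def, mul_smul]
      rfl⟩
  let g' : M →ₗ[A] N := g
  have : IsLocalizedModule S g' := hg
  exact Module.injective_of_isLocalizedModule S g'

lemma injective_extendScalars_obj (S : Submonoid A) [IsLocalization S B]
    [IsNoetherianRing A] (M : ModuleCat.{u} A) [Injective M] :
    Injective ((extendScalars.{u, u, u} (algebraMap A B)).obj M) :=
  injective_of_isLocalizedModule_restrictScalars S M _
    ((extendRestrictScalarsAdj (algebraMap A B)).unit.app M).hom (hg := isLocalizedModule_unit S M)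

/-- Maps out of a finitely presented module commute with localization: only finitely many images of
generators and relations among them need denominators. -/
lemma exists_smul_eq_extendScalars_map (S : Submonoid A) [IsLocalization S B]
    {M N : ModuleCat.{u} A} [hM : Module.FinitePresentation A M]
    (ψ : (extendScalars.{u, u, u} (algebraMap A B)).obj M ⟶
      (extendScalars.{u, u, u} (algebraMap A B)).obj N) :
    ∃ s ∈ S, ∃ φ : M ⟶ N, algebraMap A B s • ψ = (extendScalars (algebraMap A B)).map φ := by
  let η := (extendRestrictScalarsAdj (algebraMap A B)).unit
  have : Module.FinitePresentation A ((𝟭 (ModuleCat A)).obj M) := hM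
  obtain ⟨h, s, hs⟩ := Module.FinitePresentation.exists_lift_of_isLocalizedModule S (η.app N).hom
    (η.app M ≫ (restrictScalars _).map ψ).hom
  refine ⟨s, s.2, ModuleCat.ofHom h, ?_⟩
  refine ExtendScalars.hom_ext fun m => ?_
  exact (LinearMap.congr_fun hs m).symm

lemma exists_smul_eq_zero_of_extendScalars_map (S : Submonoid A) [IsLocalization S B]
    {M N : ModuleCat.{u} A} [Module.Finite A M] (φ : M ⟶ N)
    (h : (extendScalars.{u, u, u} (algebraMap A B)).map φ = 0) : ∃ s ∈ S, s • φ = 0 := by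
  let η := (extendRestrictScalarsAdj (algebraMap A B)).unit
  obtain ⟨s, hs⟩ := Module.Finite.exists_smul_of_comp_eq_of_isLocalizedModule S (η.app N).hom
    φ.hom 0 (by
      have hφ : φ ≫ η.app N = 0 := by
        refine (η.naturality φ).trans ?_
        change _ ≫ (restrictScalars _).map ((extendScalars (algebraMap A B)).map φ) = 0
        rw [h, Functor.map_zero, Limits.comp_zero]
      rw [LinearMap.comp_zero]
      exact congrArg ModuleCat.Hom.hom hφ)
  refine ⟨s, s.2, ModuleCat.hom_ext ?_⟩
  rw [smul_zero] at hs
  exact hs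

end LocalizationModules

/-! ### Localization of cochains and of dualizing complexes -/

section LocalizationComplexes

open ModuleCat

lemma exists_common_multiple {A ι : Type*} [CommMonoid A] (S : Submonoid A)
    (P : ι → A → Prop) (hP : ∀ i s t, P i s → P i (t * s)) (I : Finset ι)
    (h : ∀ i ∈ I, ∃ s ∈ S, P i s) : ∃ s ∈ S, ∀ i ∈ I, P i s := by
  classical
  induction I using Finset.induction_on with
  | empty => exact ⟨1, S.one_mem, by simp⟩
  | insert i I _ ih =>
    obtain ⟨s, hs, hs'⟩ := ih fun j hj => h j (Finset.mem_insert_of_mem hj)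
    obtain ⟨t, ht, ht'⟩ := h i (Finset.mem_insert_self i I)
    refine ⟨s * t, S.mul_mem hs ht, fun j hj => ?_⟩
    obtain rfl | hj := Finset.mem_insert.1 hj
    · exact hP _ _ _ ht'
    · rw [mul_comm]
      exact hP _ _ _ (hs' j hj)

variable {A : Type u} (B : Type u) [CommRing A] [CommRing B] [Algebra A B]

/-- The base change of a morphism of complexes. -/
abbrev baseChangeMap {K L : Complexes A} (f : K ⟶ L) : baseChange B K ⟶ baseChange B L :=
  ((extendScalars.{u, u, u} (algebraMap A B)).mapHomologicalComplex (ComplexShape.up ℤ)).map f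

/-- The base change of a cochain. -/
def baseChangeCochain {K L : Complexes A} {n : ℤ} (z : Cochain K L n) :
    Cochain (baseChange B K) (baseChange B L) n :=
  z.map (extendScalars.{u, u, u} (algebraMap A B))

variable {B}

lemma baseChangeCochain_smul {K L : Complexes A} {n : ℤ} (a : A) (z : Cochain K L n) :
    baseChangeCochain B (a • z) = algebraMap A B a • baseChangeCochain B z := by
  refine Cochain.ext _ _ fun p q hpq => ?_
  exact extendScalars_map_smul _ _ _

lemma baseChangeCochain_add {K L : Complexes A} {n : ℤ} (z z' : Cochain K L n) :
    baseChangeCochain B (z + z') = baseChangeCochain B z + baseChangeCochain B z' :=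
  Cochain.map_add z z' _

lemma baseChangeCochain_sub {K L : Complexes A} {n : ℤ} (z z' : Cochain K L n) :
    baseChangeCochain B (z - z') = baseChangeCochain B z - baseChangeCochain B z' :=
  Cochain.map_sub z z' _

lemma δ_baseChangeCochain {K L : Complexes A} {n : ℤ} (m : ℤ) (z : Cochain K L n) :
    δ n m (baseChangeCochain B z) = baseChangeCochain B (δ n m z) :=
  δ_map n m z _

lemma baseChangeCochain_ofHom {K L : Complexes A} (f : K ⟶ L) :
    baseChangeCochain B (Cochain.ofHom f) = Cochain.ofHom (baseChangeMap B f) :=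
  Cochain.map_ofHom _ _ f _

lemma quasiIso_baseChangeMap (S : Submonoid A) [IsLocalization S B] {K L : Complexes A}
    (f : K ⟶ L) [QuasiIso f] : QuasiIso (baseChangeMap B f) := by
  have := preservesFiniteLimits_extendScalars_of_isLocalization (B := B) S
  exact HomologicalComplex.quasiIso_map_of_preservesHomology f
    (extendScalars.{u, u, u} (algebraMap A B))

/-- Extension of scalars to a localization commutes with cohomology. -/
lemma nonempty_homology_baseChange_iso (S : Submonoid A) [IsLocalization S B] (K : Complexes A)
    (n : ℤ) : Nonempty ((baseChange B K).homology n ≅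
      (extendScalars.{u, u, u} (algebraMap A B)).obj (K.homology n)) := by
  have := preservesFiniteLimits_extendScalars_of_isLocalization (B := B) S
  exact ⟨(K.sc n).mapHomologyIso (extendScalars.{u, u, u} (algebraMap A B))⟩

lemma exactAt_baseChange (S : Submonoid A) [IsLocalization S B] (K : Complexes A) (n : ℤ)
    (h : K.ExactAt n) : (baseChange B K).ExactAt n := by
  rw [HomologicalComplex.exactAt_iff_isZero_homology] at h ⊢
  obtain ⟨e⟩ := nonempty_homology_baseChange_iso (B := B) S K n
  exact ((extendScalars.{u, u, u} (algebraMap A B)).map_isZero h).of_iso e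

lemma hasBoundedCohomology_baseChange (S : Submonoid A) [IsLocalization S B] {K : Complexes A}
    (h : HasBoundedCohomology K) : HasBoundedCohomology (baseChange B K) := by
  obtain ⟨a, b, hab⟩ := h
  refine ⟨a, b, fun i hi => ?_⟩
  rw [subsingleton_homology_iff]
  exact exactAt_baseChange S K i ((subsingleton_homology_iff K i).1 (hab i hi))

lemma hasFGCohomology_baseChange (S : Submonoid A) [IsLocalization S B] {K : Complexes A}
    (h : HasFGCohomology K) : HasFGCohomology (baseChange B K) := by
  intro i
  have := h i
  obtain ⟨e⟩ := nonempty_homology_baseChange_iso (B := B) S K i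
  have := finite_extendScalars_obj (algebraMap A B) (K.homology i)
  exact Module.Finite.equiv e.symm.toLinearEquiv

/-- A cochain of degree `n` has one component for each target degree `q`, and only those with `a ≤ q
≤ b` can be nonzero. Finitely many denominators have a common multiple in `S`. -/
lemma exists_smul_eq_baseChangeCochain (S : Submonoid A) [IsLocalization S B] {F J : Complexes A}
    [∀ n, Module.FinitePresentation A (F.X n)] (a b : ℤ) [J.IsStrictlyGE a] [J.IsStrictlyLE b]
    {n : ℤ}
    (ψ : Cochain (baseChange B F) (baseChange B J) n) :
    ∃ s ∈ S, ∃ φ : Cochain F J n, algebraMap A B s • ψ = baseChangeCochain B φ := by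
  obtain ⟨s, hs, h⟩ := exists_common_multiple S
    (fun (q : ℤ) (s : A) => ∀ (p : ℤ) (hpq : p + n = q), ∃ φ : F.X p ⟶ J.X q,
      algebraMap A B s • ψ.v p q hpq = (extendScalars.{u, u, u} (algebraMap A B)).map φ)
    (fun q s t h p hpq => by
      obtain ⟨φ, hφ⟩ := h p hpq
      exact ⟨t • φ, by
        rw [map_mul, mul_smul, hφ, extendScalars_map_smul]
        rfl⟩)
    (Finset.Icc a b) (fun q _ => by
      obtain ⟨s, hs, φ, hφ⟩ := exists_smul_eq_extendScalars_map S (ψ.v (q - n) q (by simp))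
      refine ⟨s, hs, fun p hpq => ?_⟩
      obtain rfl : p = q - n := by lia
      exact ⟨φ, hφ⟩)
  have h' (p q : ℤ) (hpq : p + n = q) : ∃ φ : F.X p ⟶ J.X q,
      algebraMap A B s • ψ.v p q hpq = (extendScalars.{u, u, u} (algebraMap A B)).map φ := by
    by_cases hq : q ∈ Finset.Icc a b
    · exact h q hq p hpq
    · have hz : Limits.IsZero (J.X q) := by
        rw [Finset.mem_Icc, not_and_or, not_le, not_le] at hq
        obtain hq | hq := hq
        · exact J.isZero_of_isStrictlyGE a q hq
        · exact J.isZero_of_isStrictlyLE b q hq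
      exact ⟨0, ((extendScalars.{u, u, u} (algebraMap A B)).map_isZero hz).eq_of_tgt _ _⟩
  choose φ hφ using h'
  exact ⟨s, hs, Cochain.mk φ, Cochain.ext _ _ hφ⟩

lemma exists_smul_eq_zero_of_baseChangeCochain (S : Submonoid A) [IsLocalization S B]
    {F J : Complexes A} [∀ n, Module.FinitePresentation A (F.X n)] (a b : ℤ) [J.IsStrictlyGE a]
    [J.IsStrictlyLE b] {n : ℤ} (φ : Cochain F J n)
    (h : baseChangeCochain B φ = 0) : ∃ s ∈ S, s • φ = 0 := by
  obtain ⟨s, hs, h⟩ := exists_common_multiple S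
    (fun (q : ℤ) (s : A) => ∀ (p : ℤ) (hpq : p + n = q), s • φ.v p q hpq = 0)
    (fun q s t h p hpq => by rw [mul_smul, h, smul_zero])
    (Finset.Icc a b) (fun q _ => by
      obtain ⟨s, hs, hφ⟩ := exists_smul_eq_zero_of_extendScalars_map (B := B) S
        (φ.v (q - n) q (by simp)) (Cochain.congr_v h (q - n) q (by simp))
      refine ⟨s, hs, fun p hpq => ?_⟩
      obtain rfl : p = q - n := by lia
      exact hφ)
  refine ⟨s, hs, Cochain.ext _ _ fun p q hpq => ?_⟩
  by_cases hq : q ∈ Finset.Icc a b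
  · exact h q hq p hpq
  · have hz : Limits.IsZero (J.X q) := by
      rw [Finset.mem_Icc, not_and_or, not_le, not_le] at hq
      obtain hq | hq := hq
      · exact J.isZero_of_isStrictlyGE a q hq
      · exact J.isZero_of_isStrictlyLE b q hq
    exact hz.eq_of_tgt _ _

/-- If `A ⟶ Hom(F, J)` is a quasi-isomorphism, so is its localization. -/
lemma homothetyBijective_baseChangeMap (S : Submonoid A) [IsLocalization S B] {F J : Complexes A}
    [∀ n, Module.FinitePresentation A (F.X n)] (a b : ℤ) [J.IsStrictlyGE a] [J.IsStrictlyLE b]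
    (i : F ⟶ J) (h : HomothetyBijective A i) :
    HomothetyBijective B (baseChangeMap B i) := by
  have hunit {s : A} (hs : s ∈ S) : IsUnit (algebraMap A B s) :=
    IsLocalization.map_units B (⟨s, hs⟩ : S)
  have hi (a : A) : baseChangeCochain B (a • Cochain.ofHom i) =
      algebraMap A B a • Cochain.ofHom (baseChangeMap B i) := by
    rw [baseChangeCochain_smul, baseChangeCochain_ofHom]
  -- Clearing denominators gives a cochain over `A` whose differential vanishes only after
  -- localization; a further factor `t` in `S` makes it a cocycle.
  have hlift {n m : ℤ} (z : Cochain (baseChange B F) (baseChange B J) n) (hz : δ n m z = 0) :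
      ∃ s ∈ S, ∃ φ : Cochain F J n, δ n m φ = 0 ∧
        algebraMap A B s • z = baseChangeCochain B φ := by
    obtain ⟨s, hs, φ, hφ⟩ := exists_smul_eq_baseChangeCochain S a b z
    obtain ⟨t, ht, hφ'⟩ := exists_smul_eq_zero_of_baseChangeCochain (B := B) S a b (δ n m φ) (by
      rw [← δ_baseChangeCochain, ← hφ, δ_smul, hz, smul_zero])
    refine ⟨t * s, S.mul_mem ht hs, t • φ, by rw [δ_smul, hφ'], ?_⟩
    rw [baseChangeCochain_smul, map_mul, mul_smul, hφ]
  refine ⟨fun c β hβ => ?_, fun z hz => ?_, fun n hn z hz => ?_⟩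
  -- Write `c = r / s₀` and clear the denominator `s` of `β`. The relation `δ β = c • i` then holds
  -- over `A` up to a factor `t`, so `(t * s * r) • i` is a coboundary over `A`; thus `t * s * r =
  -- 0`, and `c = 0`.
  · obtain ⟨⟨r, s₀⟩, hr⟩ := IsLocalization.surj S c
    obtain ⟨s, hs, φ, hφ⟩ := exists_smul_eq_baseChangeCochain S a b β
    obtain ⟨t, ht, ht'⟩ := exists_smul_eq_zero_of_baseChangeCochain (B := B) S a b
      (δ (-1) 0 ((s₀ : A) • φ) - (s * r) • Cochain.ofHom i) (by
        rw [baseChangeCochain_sub, ← δ_baseChangeCochain, hi, baseChangeCochain_smul, ← hφ,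
          δ_smul, δ_smul, hβ, smul_smul, smul_smul, map_mul, ← sub_smul]
        have : algebraMap A B s₀ * (algebraMap A B s * c) -
            algebraMap A B s * algebraMap A B r = 0 := by
          rw [← hr]
          ring
        rw [mul_assoc, this, zero_smul])
    have h0 : t * (s * r) = 0 := h.injective _ (t • (s₀ : A) • φ) (by
      rw [smul_sub, smul_smul, sub_eq_zero] at ht'
      rw [δ_smul, ht'])
    have h1 : algebraMap A B (t * s) * (c * algebraMap A B s₀) = 0 := by
      rw [hr, ← map_mul, mul_assoc, h0, map_zero]
    rw [(hunit (S.mul_mem ht hs)).mul_right_eq_zero, (hunit s₀.2).mul_left_eq_zero] at h1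
    exact h1
  · obtain ⟨s, hs, φ, hφ, hφ'⟩ := hlift z hz
    obtain ⟨r, β, hβ⟩ := h.surjective φ hφ
    obtain ⟨u, hu⟩ := hunit hs
    refine ⟨(↑u⁻¹ : B) * algebraMap A B r, (↑u⁻¹ : B) • baseChangeCochain B β, ?_⟩
    have hz' : z = (↑u⁻¹ : B) • baseChangeCochain B φ := by
      rw [← hφ', smul_smul, ← hu, Units.inv_mul, one_smul]
    rw [hz', hβ, baseChangeCochain_add, ← δ_baseChangeCochain, δ_smul, mul_smul, ← hi, smul_add]
  · obtain ⟨s, hs, φ, hφ, hφ'⟩ := hlift z hz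
    obtain ⟨β, hβ⟩ := h.exact n hn φ hφ
    obtain ⟨u, hu⟩ := hunit hs
    refine ⟨(↑u⁻¹ : B) • baseChangeCochain B β, ?_⟩
    have hz' : z = (↑u⁻¹ : B) • baseChangeCochain B φ := by
      rw [← hφ', smul_smul, ← hu, Units.inv_mul, one_smul]
    rw [hz', δ_smul, ← hβ, δ_baseChangeCochain]

end LocalizationComplexes

attribute [local instance] HasDerivedCategory.standard in
lemma isDualizing_baseChange {A : Type u} [CommRing A] [IsNoetherianRing A] (S : Submonoid A)
    (B : Type u) [CommRing B] [Algebra A B] [IsLocalization S B] {R : Complexes A}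
    (hR : IsDualizing R) : IsDualizing (baseChange B R) := by
  obtain ⟨J, f, a, b, hf, hJ, hJa, hJb⟩ := exists_bounded_injective_of_hasFiniteInjectiveDimension
    R hR.bounded hR.finiteInjectiveDimension
  have := isKInjective_of_injective J a
  have hfg : HasFGCohomology J := fun n => by
    have := hR.fg n
    exact Module.Finite.equiv (asIso (HomologicalComplex.homologyMap f n)).toLinearEquiv
  obtain ⟨F, i, hi, hF⟩ := exists_fg_quasiIso J hfg b
  have hF' (n : ℤ) : Module.FinitePresentation A (F.X n) :=
    Module.finitePresentation_of_finite A _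
  have hfB : QuasiIso (baseChangeMap B f) := quasiIso_baseChangeMap S f
  have hiB : QuasiIso (baseChangeMap B i) := quasiIso_baseChangeMap S i
  have hJB (n : ℤ) : Injective ((baseChange B J).X n) :=
    injective_extendScalars_obj S (J.X n)
  have hJaB : (baseChange B J).IsStrictlyGE a := by
    rw [isStrictlyGE_iff]
    exact fun n hn => (ModuleCat.extendScalars.{u, u, u} (algebraMap A B)).map_isZero
      (J.isZero_of_isStrictlyGE a n hn)
  have hJbB : (baseChange B J).IsStrictlyLE b := by
    rw [isStrictlyLE_iff]
    exact fun n hn => (ModuleCat.extendScalars.{u, u, u} (algebraMap A B)).map_isZero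
      (J.isZero_of_isStrictlyLE b n hn)
  have := isKInjective_of_injective (baseChange B J) a
  refine ⟨hasBoundedCohomology_baseChange S hR.bounded, hasFGCohomology_baseChange S hR.fg,
    hasFiniteInjectiveDimension_of_quasiIso b (baseChangeMap B f), ?_⟩
  -- `R` and `F` are both quasi-isomorphic to `J`. The condition is moved from `R` to `F`, localized
  -- there, and moved back to `B ⊗ R`.
  have hi' : HomothetyBijective A i :=
    ((canonicalMorphismIsIso_iff R f).1 hR.canonical).of_quasiIso i (Iso.refl _)
  rw [canonicalMorphismIsIso_iff _ (baseChangeMap B f)]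
  exact (homothetyBijective_baseChangeMap S a b i hi').of_quasiIso _ (Iso.refl _)

/-! ### Projective dimension over polynomial rings -/

section GlobalDimension

open TensorProduct Polynomial

/-- Flat base change of a short exact sequence of modules. -/
lemma exists_shortExact_baseChange {A : Type u} (B : Type u) [CommRing A] [CommRing B]
    [Algebra A B] [Module.Flat A B] {K F M : Type u} [AddCommGroup K] [Module A K]
    [AddCommGroup F] [Module A F] [AddCommGroup M] [Module A M] (j : K →ₗ[A] F) (p : F →ₗ[A] M)
    (hj : Function.Injective j) (h : Function.Exact j p) (hp : Function.Surjective p) :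
    ∃ (f : ModuleCat.of B (B ⊗[A] K) ⟶ ModuleCat.of B (B ⊗[A] F))
      (g : ModuleCat.of B (B ⊗[A] F) ⟶ ModuleCat.of B (B ⊗[A] M)) (w : f ≫ g = 0),
      (ShortComplex.mk f g w).ShortExact := by
  have hB : Function.Exact (j.baseChange B) (p.baseChange B) := lTensor_exact B h hp
  exact ⟨ModuleCat.ofHom (j.baseChange B), ModuleCat.ofHom (p.baseChange B),
    ModuleCat.hom_ext hB.linearMap_comp_eq_zero, ModuleCat.shortComplex_shortExact _ hB
      (Module.Flat.lTensor_preserves_injective_linearMap j hj)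
      (LinearMap.lTensor_surjective B hp)⟩

/-- Dimension shifting along a free cover of `M`: flat base change keeps the sequence exact and its
middle term projective. -/
lemma hasProjectiveDimensionLT_baseChange {A B : Type u} [CommRing A] [CommRing B] [Algebra A B]
    [Module.Flat A B] (n : ℕ) (M : Type u) [AddCommGroup M] [Module A M]
    (hM : HasProjectiveDimensionLT (ModuleCat.of A M) (n + 1)) :
    HasProjectiveDimensionLT (ModuleCat.of B (B ⊗[A] M)) (n + 1) := by
  induction n generalizing M with
  | zero =>
    rw [zero_add, ← projective_iff_hasProjectiveDimensionLT_one,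
      ← IsProjective.iff_projective] at hM ⊢
    have : Module.Projective A M := hM
    infer_instance
  | succ n ih =>
    let p : (M →₀ A) →ₗ[A] M := Finsupp.linearCombination A id
    have hp : Function.Surjective p := Finsupp.linearCombination_id_surjective A M
    have hS := LinearMap.shortExact_shortComplexKer hp
    have hproj : Projective (ModuleCat.of A (M →₀ A)) :=
      (IsProjective.iff_projective (R := A) (M →₀ A)).1 inferInstance
    have hK : HasProjectiveDimensionLT (ModuleCat.of A (LinearMap.ker p)) (n + 1) :=
      (hS.hasProjectiveDimensionLT_X₃_iff n hproj).1 hM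
    obtain ⟨f, g, w, hT⟩ := exists_shortExact_baseChange B (K := LinearMap.ker p)
      (F := M →₀ A) (M := M) (LinearMap.ker p).subtype p
      (Submodule.injective_subtype (LinearMap.ker p)) (fun x => by simp [p]) hp
    have hprojB : Projective (ModuleCat.of B (B ⊗[A] (M →₀ A))) :=
      (IsProjective.iff_projective _).1 inferInstance
    exact (hT.hasProjectiveDimensionLT_X₃_iff n hprojB).2 (ih _ hK)

section Difference

variable {A B : Type u} [CommRing A] [CommRing B] [Algebra A B] (M : Type u) [AddCommGroup M]
  [Module A M] [Module B M] [IsScalarTower A B M]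

/-- The difference of the two actions of `x : B` on `B ⊗ M`. -/
def actionDifference (x : B) : B ⊗[A] M →ₗ[B] B ⊗[A] M :=
  LinearMap.liftBaseChange B (TensorProduct.mk A B M x -
    (TensorProduct.mk A B M 1) ∘ₗ (LinearMap.lsmul B M x).restrictScalars A)

variable {M}

lemma actionDifference_tmul (x p : B) (m : M) :
    actionDifference (A := A) M x (p ⊗ₜ[A] m) = (p * x) ⊗ₜ[A] m - p ⊗ₜ[A] (x • m) := by
  simp [actionDifference, smul_sub, smul_tmul']

end Difference

variable {A : Type u} [CommRing A] (M : Type u) [AddCommGroup M] [Module A M] [Module A[X] M]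
  [IsScalarTower A A[X] M]

/-- The difference of the two actions of `X` on `A[X] ⊗ M`. -/
def polynomialDifference : A[X] ⊗[A] M →ₗ[A[X]] A[X] ⊗[A] M :=
  actionDifference M X

/-- The action of `A[X]` on `M`. -/
def polynomialAction : A[X] ⊗[A] M →ₗ[A[X]] M :=
  LinearMap.liftBaseChange A[X] LinearMap.id

variable {M}

lemma polynomialDifference_tmul (p : A[X]) (m : M) :
    polynomialDifference M (p ⊗ₜ[A] m) = (p * X) ⊗ₜ[A] m - p ⊗ₜ[A] ((X : A[X]) • m) :=
  actionDifference_tmul X p m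

lemma polynomialAction_tmul (p : A[X]) (m : M) :
    polynomialAction M (p ⊗ₜ[A] m) = p • m := by
  simp [polynomialAction]

lemma polynomialAction_comp_polynomialDifference :
    polynomialAction (A := A) M ∘ₗ polynomialDifference M = 0 := by
  refine LinearMap.ext fun t => ?_
  induction t using TensorProduct.induction_on with
  | zero => simp
  | add x y hx hy => rw [map_add, hx, hy]; simp
  | tmul p m =>
    simp [polynomialDifference_tmul, polynomialAction_tmul, mul_smul]

/-- Modulo the range, powers of `X` can be moved across the tensor sign, so every tensor is
congruent to one of the form `1 ⊗ m`. This gives exactness in the middle of the sequence below. -/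
lemma sub_one_tmul_mem_range (t : A[X] ⊗[A] M) :
    t - 1 ⊗ₜ[A] polynomialAction M t ∈ LinearMap.range (polynomialDifference M) := by
  induction t using TensorProduct.induction_on with
  | zero => simp
  | add x y hx hy =>
    have := add_mem hx hy
    rwa [← add_sub_add_comm, ← TensorProduct.tmul_add, ← map_add] at this
  | tmul p m =>
    rw [polynomialAction_tmul]
    induction p using Polynomial.induction_on' with
    | add p q hp hq =>
      have := add_mem hp hq
      rwa [← add_sub_add_comm, ← TensorProduct.tmul_add, ← TensorProduct.add_tmul,
        ← add_smul] at this
    | monomial n a =>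
      induction n generalizing m with
      | zero =>
        rw [monomial_zero_left, ← mul_one (C a), ← smul_eq_C_mul, smul_assoc, one_smul,
          TensorProduct.smul_tmul, sub_self]
        exact zero_mem _
      | succ n ih =>
        have h₁ : polynomialDifference M ((monomial n a) ⊗ₜ[A] m) ∈
          LinearMap.range (polynomialDifference M) := ⟨_, rfl⟩
        rw [polynomialDifference_tmul, monomial_mul_X] at h₁
        have h₂ := add_mem h₁ (ih ((X : A[X]) • m))
        rwa [sub_add_sub_cancel, ← mul_smul, monomial_mul_X] at h₂

/-- View `t` as a polynomial with coefficients `t_n` in `M`. If `t` is in the kernel then `t_n = X •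
t_{n+1}` for all `n`; as `t_n = 0` for large `n`, descending induction gives `t = 0`. -/
lemma polynomialDifference_injective : Function.Injective (polynomialDifference (A := A) M) := by
  let e := PolynomialModule.polynomialTensorProductLEquivPolynomialModule A M
  have he (p : A[X]) (m : M) (n : ℕ) : (e (p ⊗ₜ[A] m)).coeff n = p.coeff n • m := by
    have : e (p ⊗ₜ[A] m) = p • PolynomialModule.single A 0 m :=
      LinearMap.liftBaseChange_tmul ..
    rw [this, PolynomialModule.smul_single_apply]
    simp
  have hcomm (a : A) (m : M) : (X : A[X]) • a • m = a • (X : A[X]) • m := by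
    rw [← smul_assoc a (X : A[X]) m, ← algebraMap_smul A[X] a m, ← mul_smul, Algebra.smul_def,
      mul_comm]
  have hcoeff (t : A[X] ⊗[A] M) (n : ℕ) : (e (polynomialDifference M t)).coeff (n + 1) =
      (e t).coeff n - (X : A[X]) • (e t).coeff (n + 1) := by
    induction t using TensorProduct.induction_on with
    | zero => simp
    | add x y hx hy =>
      simp only [map_add, PolynomialModule.coeff_add, Finsupp.add_apply, hx, hy, smul_add]
      abel
    | tmul p m =>
      rw [polynomialDifference_tmul, map_sub]
      have : (e ((p * X) ⊗ₜ[A] m) - e (p ⊗ₜ[A] ((X : A[X]) • m))).coeff (n + 1) =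
        (e ((p * X) ⊗ₜ[A] m)).coeff (n + 1) - (e (p ⊗ₜ[A] ((X : A[X]) • m))).coeff (n + 1) := rfl
      rw [this, he, he, he, he, coeff_mul_X, hcomm]
  rw [injective_iff_map_eq_zero]
  intro t ht
  have hc (n : ℕ) : (e t).coeff n = (X : A[X]) • (e t).coeff (n + 1) := by
    have := hcoeff t n
    rw [ht, map_zero, PolynomialModule.coeff_zero, Finsupp.zero_apply, eq_comm,
      sub_eq_zero] at this
    exact this
  obtain ⟨N, hN⟩ : ∃ N, ∀ n, N ≤ n → (e t).coeff n = 0 := by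
    refine ⟨(e t).coeff.support.sup id + 1, fun n hn => ?_⟩
    by_contra h
    have := Finset.le_sup (f := id) (Finsupp.mem_support_iff.2 h)
    simp only [id] at this
    lia
  have hz (k : ℕ) : ∀ n, N ≤ n + k → (e t).coeff n = 0 := by
    induction k with
    | zero => exact fun n hn => hN n (by simpa using hn)
    | succ k ih => exact fun n hn => by rw [hc, ih (n + 1) (by lia), smul_zero]
  apply e.injective
  rw [map_zero]
  apply PolynomialModule.coeff_injective
  ext n
  exact hz N n (by lia)

/-- The sequence `0 → A[X] ⊗ M → A[X] ⊗ M → M → 0` is exact, and its first two terms have projective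
dimension at most `n` over `A[X]`. -/
lemma hasProjectiveDimensionLT_polynomial (n : ℕ)
    (h : HasProjectiveDimensionLT (ModuleCat.of A M) (n + 1)) :
    HasProjectiveDimensionLT (ModuleCat.of A[X] M) (n + 2) := by
  let T : ShortComplex (ModuleCat.{u} A[X]) := ModuleCat.shortComplexOfCompEqZero
    (polynomialDifference M) (polynomialAction M) polynomialAction_comp_polynomialDifference
  have hT : T.ShortExact := by
    refine ModuleCat.shortComplex_shortExact _ (fun t => ⟨fun ht => ?_, ?_⟩)
      polynomialDifference_injective (fun m => ⟨1 ⊗ₜ[A] m, ?_⟩)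
    · have := sub_one_tmul_mem_range t
      have ht' : polynomialAction M t = 0 := ht
      rw [ht', TensorProduct.tmul_zero, sub_zero] at this
      exact this
    · rintro ⟨x, rfl⟩
      exact LinearMap.congr_fun polynomialAction_comp_polynomialDifference x
    · exact (polynomialAction_tmul _ _).trans (one_smul _ _)
  have h₁ := hasProjectiveDimensionLT_baseChange (B := A[X]) n M h
  exact hT.hasProjectiveDimensionLT_X₃ (n + 1) h₁
    (hasProjectiveDimensionLT_of_ge _ (n + 1) _ (by simp))

end GlobalDimension

/-! ### Algebras of finite type as quotients of regular rings -/

section Regular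

open Polynomial

variable {A : Type u} [CommRing A]

lemma hasFiniteGlobalDimension_iff : HasFiniteGlobalDimension A ↔
    ∃ d : ℕ, ∀ M : ModuleCat.{u} A, HasProjectiveDimensionLT M (d + 1) := by
  constructor
  · rintro ⟨d, hd⟩
    refine ⟨d, fun M => HasProjectiveDimensionLT.mk fun i hi Y e => ?_⟩
    have := hd M Y i hi
    exact Subsingleton.elim _ _
  · rintro ⟨d, hd⟩
    refine ⟨d, fun M N i hi => ?_⟩
    have := hd M
    exact HasProjectiveDimensionLT.subsingleton M (d + 1) i hi N

lemma HasFiniteGlobalDimension.polynomial (h : HasFiniteGlobalDimension A) :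
    HasFiniteGlobalDimension A[X] := by
  rw [hasFiniteGlobalDimension_iff] at h ⊢
  obtain ⟨d, hd⟩ := h
  refine ⟨d + 1, fun M => ?_⟩
  let _ : Module A M := Module.compHom M (algebraMap A A[X])
  have : IsScalarTower A A[X] M := ⟨fun a p m => by
    rw [Algebra.smul_def, mul_smul]
    rfl⟩
  exact hasProjectiveDimensionLT_polynomial d (hd (ModuleCat.of A M))

lemma exists_surjective_of_algEquiv {B C : Type*} [CommRing B] [CommRing C] [Algebra A B]
    [Algebra A C] (e : B ≃ₐ[A] C) : ∃ g : C →+* B, Function.Surjective g :=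
  ⟨e.symm.toRingEquiv.toRingHom, e.symm.surjective⟩

/-- `P` is an iterated one-variable polynomial ring. A surjection is all that is needed, and it
spares the transport of global dimension along a ring isomorphism. -/
lemma exists_regular_surjective_mvPolynomial [IsNoetherianRing A]
    (h : HasFiniteGlobalDimension A) (n : ℕ) :
    ∃ (P : Type u) (_ : CommRing P) (_ : IsNoetherianRing P) (f : P →+* MvPolynomial (Fin n) A),
      Function.Surjective f ∧ HasFiniteGlobalDimension P := by
  induction n with
  | zero =>
    refine ⟨A, inferInstance, inferInstance, MvPolynomial.C, ?_, h⟩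
    exact MvPolynomial.C_surjective (Fin 0)
  | succ n ih =>
    obtain ⟨P, _, _, f, hf, hP⟩ := ih
    obtain ⟨g, hg⟩ : ∃ g : (MvPolynomial (Fin n) A)[X] →+* MvPolynomial (Fin (n + 1)) A,
        Function.Surjective g := exists_surjective_of_algEquiv (MvPolynomial.finSuccEquiv A n)
    refine ⟨P[X], inferInstance, inferInstance, g.comp (Polynomial.mapRingHom f), ?_,
      hP.polynomial⟩
    rw [RingHom.coe_comp]
    exact hg.comp (Polynomial.map_surjective f hf)

/-- An algebra of finite type over a regular ring is a quotient of a regular ring. -/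
lemma exists_regular_surjective [IsNoetherianRing A] (h : HasFiniteGlobalDimension A)
    (B : Type u) [CommRing B] [Algebra A B] [Algebra.FiniteType A B] :
    ∃ (P : Type u) (_ : CommRing P) (_ : IsNoetherianRing P) (f : P →+* B),
      Function.Surjective f ∧ HasFiniteGlobalDimension P := by
  obtain ⟨n, g, hg⟩ := Algebra.FiniteType.iff_quotient_mvPolynomial''.1 ‹Algebra.FiniteType A B›
  obtain ⟨P, _, _, f, hf, hP⟩ := exists_regular_surjective_mvPolynomial h n
  refine ⟨P, inferInstance, inferInstance, g.toRingHom.comp f, ?_, hP⟩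
  rw [RingHom.coe_comp]
  exact hg.comp hf

end Regular

/-! ### Biduality with respect to a complex of injectives -/

section Evaluation

variable {A : Type u} [CommRing A] (J : Complexes A)

/-- The complex `Hom_A(M, J)`, for a module `M`. -/
def moduleDual (M : ModuleCat.{u} A) : Complexes A where
  X n := ModuleCat.of A (M →ₗ[A] J.X n)
  d i j := ModuleCat.ofHom (LinearMap.compRight A (J.d i j).hom)
  shape i j hij := by
    rw [J.shape i j hij]
    exact ModuleCat.hom_ext (LinearMap.ext fun φ => LinearMap.zero_comp φ)
  d_comp_d' i j k _ _ := by
    refine ModuleCat.hom_ext (LinearMap.ext fun φ => LinearMap.ext fun m => ?_)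
    exact ConcreteCategory.congr_hom (J.d_comp_d i j k) (φ m)

/-- The map `Hom_A(N, J) ⟶ Hom_A(M, J)` induced by `g : M ⟶ N`. -/
def moduleDualMap {M N : ModuleCat.{u} A} (g : M ⟶ N) : moduleDual J N ⟶ moduleDual J M where
  f _ := ModuleCat.ofHom (LinearMap.lcomp A _ g.hom)
  comm' _ _ _ := rfl

/-- The map `Hom_A(M, J) ⟶ J` given by evaluation at `m`. -/
def evaluation {M : ModuleCat.{u} A} (m : M) : moduleDual J M ⟶ J where
  f _ := ModuleCat.ofHom (LinearMap.applyₗ m)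
  comm' _ _ _ := rfl

/-- The biduality morphism `M ⟶ Hom(Hom(M, J), J)` is a quasi-isomorphism. -/
structure EvaluationBijective (M : ModuleCat.{u} A) : Prop where
  injective : ∀ (m : M) (β : Cochain (moduleDual J M) J (-1)),
    δ (-1) 0 β = Cochain.ofHom (evaluation J m) → m = 0
  surjective : ∀ z : Cochain (moduleDual J M) J 0, δ 0 1 z = 0 →
    ∃ (m : M) (β : Cochain (moduleDual J M) J (-1)),
      z = Cochain.ofHom (evaluation J m) + δ (-1) 0 β
  exact : ∀ n : ℤ, n ≠ 0 → CocyclesAreCoboundaries (moduleDual J M) J n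

variable {J}

lemma evaluation_add {M : ModuleCat.{u} A} (m m' : M) :
    evaluation J (m + m') = evaluation J m + evaluation J m' := by
  ext n φ
  exact map_add (show M →ₗ[A] J.X n from φ) m m'

lemma evaluation_zero {M : ModuleCat.{u} A} : evaluation J (0 : M) = 0 := by
  ext n φ
  exact map_zero (show M →ₗ[A] J.X n from φ)

lemma evaluation_smul {M : ModuleCat.{u} A} (a : A) (m : M) :
    evaluation J (a • m) = a • evaluation J m := by
  ext n φ
  exact map_smul (show M →ₗ[A] J.X n from φ) a m

lemma moduleDualMap_evaluation {M N : ModuleCat.{u} A} (g : M ⟶ N) (m : M) :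
    moduleDualMap J g ≫ evaluation J m = evaluation J (g m) := rfl

lemma ofHom_moduleDualMap_comp_evaluation {M N : ModuleCat.{u} A} (g : M ⟶ N) (m : M) :
    (Cochain.ofHom (moduleDualMap J g)).comp (Cochain.ofHom (evaluation J m)) (zero_add 0) =
      Cochain.ofHom (evaluation J (g m)) := by
  rw [← Cochain.ofHom_comp, moduleDualMap_evaluation]

variable (J) in
/-- The complex `0 ⟶ Hom(M'', J) ⟶ Hom(M, J) ⟶ Hom(M', J) ⟶ 0`. -/
def moduleDualShortComplex (S : ShortComplex (ModuleCat.{u} A)) : ShortComplex (Complexes A) where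
  X₁ := moduleDual J S.X₃
  X₂ := moduleDual J S.X₂
  X₃ := moduleDual J S.X₁
  f := moduleDualMap J S.g
  g := moduleDualMap J S.f
  zero := by
    ext n φ
    refine LinearMap.ext fun m => ?_
    exact (congrArg (show S.X₃ →ₗ[A] J.X n from φ) (ConcreteCategory.congr_hom S.zero m)).trans
      (map_zero (show S.X₃ →ₗ[A] J.X n from φ))

lemma shortExact_moduleDual (hJ : ∀ n, Injective (J.X n)) {S : ShortComplex (ModuleCat.{u} A)}
    (hS : S.ShortExact) : (moduleDualShortComplex J S).ShortExact := by
  have := hS.mono_f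
  have := hS.epi_g
  refine HomologicalComplex.shortExact_of_degreewise_shortExact _ fun n => ?_
  refine ModuleCat.shortComplex_shortExact _ (fun φ => ⟨fun hφ => ?_, ?_⟩) (fun φ ψ h => ?_)
    (fun φ => ?_)
  · have h : S.f ≫ ModuleCat.ofHom (show S.X₂ →ₗ[A] J.X n from φ) = 0 := ModuleCat.hom_ext hφ
    exact ⟨(hS.exact.desc _ h).hom, congrArg ModuleCat.Hom.hom (hS.exact.g_desc _ h)⟩
  · rintro ⟨ψ, rfl⟩
    exact ConcreteCategory.congr_hom
      (HomologicalComplex.congr_hom (moduleDualShortComplex J S).zero n) ψ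
  · have : S.g ≫ ModuleCat.ofHom (show S.X₃ →ₗ[A] J.X n from φ) =
      S.g ≫ ModuleCat.ofHom (show S.X₃ →ₗ[A] J.X n from ψ) := ModuleCat.hom_ext h
    exact congrArg ModuleCat.Hom.hom ((cancel_epi _).1 this)
  · have := hJ n
    have h := Injective.comp_factorThru (ModuleCat.ofHom (show S.X₁ →ₗ[A] J.X n from φ)) S.f
    exact ⟨(Injective.factorThru (ModuleCat.ofHom (show S.X₁ →ₗ[A] J.X n from φ)) S.f).hom,
      congrArg ModuleCat.Hom.hom h⟩

section Cochains

variable {C : Type*} [Category* C] [Abelian C] {S : ShortComplex (CochainComplex C ℤ)}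
  {J : CochainComplex C ℤ}

/-- With the next two lemmas: `Hom(-, J)` turns a short exact sequence of complexes into one of
cochain groups. Only this surjectivity needs the terms of `J` to be injective. -/
lemma exists_ofHom_comp_eq (hS : S.ShortExact) (hJ : ∀ n, Injective (J.X n)) {n : ℤ}
    (z : Cochain S.X₁ J n) :
    ∃ y : Cochain S.X₂ J n, (Cochain.ofHom S.f).comp y (zero_add n) = z := by
  have := hS.mono_f
  refine ⟨Cochain.mk fun p q h => Injective.factorThru (z.v p q h) (S.f.f p), ?_⟩
  ext p q h
  simp

lemma exists_eq_ofHom_comp (hS : S.ShortExact) {n : ℤ} (y : Cochain S.X₂ J n)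
    (hy : (Cochain.ofHom S.f).comp y (zero_add n) = 0) :
    ∃ w : Cochain S.X₃ J n, (Cochain.ofHom S.g).comp w (zero_add n) = y := by
  have h (p : ℤ) := hS.map_of_exact (HomologicalComplex.eval C (ComplexShape.up ℤ) p)
  have (p : ℤ) : Epi (S.map (HomologicalComplex.eval C (ComplexShape.up ℤ) p)).g := (h p).epi_g
  have hv (p q : ℤ) (hpq : p + n = q) : S.f.f p ≫ y.v p q hpq = 0 := by
    have := Cochain.congr_v hy p q hpq
    simpa using this
  refine ⟨Cochain.mk fun p q hpq => (h p).exact.desc (y.v p q hpq) (hv p q hpq), ?_⟩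
  ext p q hpq
  rw [Cochain.zero_cochain_comp_v, Cochain.ofHom_v]
  exact (h p).exact.g_desc (y.v p q hpq) (hv p q hpq)

lemma eq_zero_of_ofHom_comp (hS : S.ShortExact) {n : ℤ} (w : Cochain S.X₃ J n)
    (hw : (Cochain.ofHom S.g).comp w (zero_add n) = 0) : w = 0 := by
  have := hS.epi_g
  ext p q hpq
  have := Cochain.congr_v hw p q hpq
  rw [Cochain.zero_cochain_comp_v, Cochain.ofHom_v, Cochain.zero_v] at this
  rw [Cochain.zero_v, ← cancel_epi (S.g.f p), this, Limits.comp_zero]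

end Cochains


/-- The five lemma, done with cochains: double dualization into `J` keeps the sequence exact, and
biduality compares its long exact cohomology sequence with `S`. -/
lemma EvaluationBijective.of_shortExact (hJ : ∀ n, Injective (J.X n))
    {S : ShortComplex (ModuleCat.{u} A)} (hS : S.ShortExact) (h₁ : EvaluationBijective J S.X₁)
    (h₂ : EvaluationBijective J S.X₂) : EvaluationBijective J S.X₃ := by
  have hT := shortExact_moduleDual hJ hS
  have hinj : Function.Injective S.f := (ModuleCat.mono_iff_injective _).1 hS.mono_f
  have hsurj : Function.Surjective S.g := (ModuleCat.epi_iff_surjective _).1 hS.epi_g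
  have hzero (k : S.X₁) : S.g (S.f k) = 0 := ConcreteCategory.congr_hom S.zero k
  have lift {n : ℤ} (z : Cochain (moduleDual J S.X₃) J n) :
      ∃ y : Cochain (moduleDual J S.X₂) J n,
        (Cochain.ofHom (moduleDualMap J S.g)).comp y (zero_add n) = z :=
    exists_ofHom_comp_eq hT hJ z
  have ker {n : ℤ} (y : Cochain (moduleDual J S.X₂) J n)
      (hy : (Cochain.ofHom (moduleDualMap J S.g)).comp y (zero_add n) = 0) :
      ∃ w : Cochain (moduleDual J S.X₁) J n,
        (Cochain.ofHom (moduleDualMap J S.f)).comp w (zero_add n) = y :=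
    exists_eq_ofHom_comp hT y hy
  have inj {n : ℤ} (w : Cochain (moduleDual J S.X₁) J n)
      (hw : (Cochain.ofHom (moduleDualMap J S.f)).comp w (zero_add n) = 0) : w = 0 :=
    eq_zero_of_ofHom_comp hT w hw
  have comp_zero {n : ℤ} (w : Cochain (moduleDual J S.X₁) J n) :
      (Cochain.ofHom (moduleDualMap J S.g)).comp
        ((Cochain.ofHom (moduleDualMap J S.f)).comp w (zero_add n)) (zero_add n) = 0 := by
    rw [← Cochain.comp_assoc_of_first_is_zero_cochain, ← Cochain.ofHom_comp]
    have : moduleDualMap J S.g ≫ moduleDualMap J S.f = 0 := (moduleDualShortComplex J S).zero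
    rw [this, Cochain.ofHom_zero, Cochain.zero_comp]
  -- Every cocycle for `S.X₃` lifts to a cocycle for `S.X₂`. The differential of any lift comes from
  -- a cocycle `w` for `S.X₁`, which must be a coboundary. The delicate degree is `n + 1 = 0`, where
  -- `w` is evaluation at some `k` up to a coboundary; then evaluation at `S.f k` is a coboundary,
  -- so `k = 0`.
  have correct {n : ℤ} (z : Cochain (moduleDual J S.X₃) J n) (hz : δ n (n + 1) z = 0) :
      ∃ (y : Cochain (moduleDual J S.X₂) J n),
        (Cochain.ofHom (moduleDualMap J S.g)).comp y (zero_add n) = z ∧ δ n (n + 1) y = 0 := by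
    obtain ⟨y, rfl⟩ := lift z
    rw [δ_ofHom_comp] at hz
    obtain ⟨w, hw⟩ := ker _ hz
    have hw' : δ (n + 1) (n + 1 + 1) w = 0 := inj _ (by rw [← δ_ofHom_comp, hw, δ_δ])
    obtain ⟨v, hv⟩ : ∃ v : Cochain (moduleDual J S.X₁) J n, δ n (n + 1) v = w := by
      by_cases hn : n + 1 = 0
      · obtain rfl : n = -1 := by lia
        obtain ⟨k, v, hk⟩ := h₁.surjective w hw'
        have : δ (-1) 0 (y - (Cochain.ofHom (moduleDualMap J S.f)).comp v (zero_add _)) =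
            Cochain.ofHom (evaluation J (S.f k)) := by
          rw [δ_sub, δ_ofHom_comp]
          change δ (-1) (-1 + 1) y - _ = _
          rw [← hw, hk, Cochain.comp_add, ofHom_moduleDualMap_comp_evaluation,
            add_sub_cancel_right]
        have hk0 : k = 0 := hinj ((h₂.injective _ _ this).trans (map_zero S.f.hom).symm)
        rw [hk0, evaluation_zero, Cochain.ofHom_zero, zero_add] at hk
        exact ⟨v, hk.symm⟩
      · have h := h₁.exact (n + 1) hn w hw'
        rwa [add_sub_cancel_right] at h
    refine ⟨y - (Cochain.ofHom (moduleDualMap J S.f)).comp v (zero_add n), ?_, ?_⟩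
    · rw [Cochain.comp_sub, comp_zero, sub_zero]
    · rw [δ_sub, δ_ofHom_comp, hv, hw, sub_self]
  refine ⟨fun m β hβ => ?_, fun z hz => ?_, fun n hn z hz => ?_⟩
  -- Lifting `β` shows that evaluation at `x + S.f k` is a coboundary for some `k`; hence `x = -S.f
  -- k`, which `S.g` kills.
  · obtain ⟨x, rfl⟩ := hsurj m
    obtain ⟨b, rfl⟩ := lift β
    obtain ⟨w, hw⟩ := ker (δ (-1) 0 b - Cochain.ofHom (evaluation J x)) (by
      rw [Cochain.comp_sub, ← δ_ofHom_comp, hβ, ofHom_moduleDualMap_comp_evaluation, sub_self])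
    obtain ⟨k, v, hk⟩ := h₁.surjective w (inj _ (by
      rw [← δ_ofHom_comp, hw, δ_sub, δ_δ, δ_ofHom, sub_zero]))
    rw [hk, Cochain.comp_add, ofHom_moduleDualMap_comp_evaluation, ← δ_ofHom_comp] at hw
    have h := h₂.injective (x + S.f k)
      (b - (Cochain.ofHom (moduleDualMap J S.f)).comp v (zero_add _)) (by
        rw [δ_sub, evaluation_add, Cochain.ofHom_add, ← sub_eq_iff_eq_add', sub_right_comm, ← hw,
          add_sub_cancel_right])
    have := congrArg S.g h
    rwa [map_add, hzero, add_zero, map_zero] at this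
  · obtain ⟨y, rfl, hy⟩ := correct z hz
    obtain ⟨m, β, rfl⟩ := h₂.surjective y hy
    exact ⟨S.g m, (Cochain.ofHom (moduleDualMap J S.g)).comp β (zero_add _), by
      rw [Cochain.comp_add, ofHom_moduleDualMap_comp_evaluation, δ_ofHom_comp]⟩
  · obtain ⟨y, rfl, hy⟩ := correct z hz
    obtain ⟨β, hβ⟩ := h₂.exact n hn y hy
    exact ⟨(Cochain.ofHom (moduleDualMap J S.g)).comp β (zero_add _), by rw [δ_ofHom_comp, hβ]⟩

lemma exists_dual_basis (M : ModuleCat.{u} A) [Module.Finite A M] [Module.Projective A M] :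
    ∃ (n : ℕ) (f : Fin n → (M ⟶ ModuleCat.of A A)) (g : Fin n → (ModuleCat.of A A ⟶ M)),
      ∑ i, f i ≫ g i = 𝟙 M := by
  obtain ⟨n, p, s, hp, hs, h⟩ := Module.Finite.exists_comp_eq_id_of_projective A M
  refine ⟨n, fun i => ModuleCat.ofHom (LinearMap.proj i ∘ₗ s),
    fun i => ModuleCat.ofHom (p ∘ₗ LinearMap.single A (fun _ => A) i), ?_⟩
  refine ModuleCat.hom_ext (LinearMap.ext fun m => ?_)
  rw [ModuleCat.hom_sum, LinearMap.sum_apply]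
  have := LinearMap.congr_fun h m
  refine Eq.trans ?_ this
  change ∑ i, p (Pi.single i (s m i)) = p (s m)
  rw [← map_sum]
  congr 1
  exact LinearMap.sum_single_apply _ _

lemma moduleDualMap_add {M N : ModuleCat.{u} A} (f g : M ⟶ N) :
    moduleDualMap J (f + g) = moduleDualMap J f + moduleDualMap J g := by
  ext n φ
  exact LinearMap.ext fun m => map_add (show N →ₗ[A] J.X n from φ) (f m) (g m)

variable (J) in
/-- `Hom(-, J)`, as a map on morphisms. -/
def moduleDualAddHom (M N : ModuleCat.{u} A) : (M ⟶ N) →+ (moduleDual J N ⟶ moduleDual J M) :=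
  AddMonoidHom.mk' (moduleDualMap J) moduleDualMap_add

lemma sum_moduleDualMap {M N : ModuleCat.{u} A} {n : ℕ} {f : Fin n → (M ⟶ N)}
    {g : Fin n → (N ⟶ M)} (h : ∑ i, f i ≫ g i = 𝟙 M) :
    ∑ i, moduleDualMap J (g i) ≫ moduleDualMap J (f i) = 𝟙 _ := by
  have := congrArg (moduleDualAddHom J M M) h
  rw [map_sum] at this
  exact this

/-- Biduality is natural and additive, and the identity of `M` is a finite sum of maps that factor
through `A`. -/
lemma EvaluationBijective.of_projective (h : EvaluationBijective J (ModuleCat.of A A))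
    (M : ModuleCat.{u} A) [Module.Finite A M] [Module.Projective A M] :
    EvaluationBijective J M := by
  obtain ⟨n, f, g, hfg⟩ := exists_dual_basis M
  have hfg' (m : M) : ∑ i, g i (f i m) = m := by
    have := LinearMap.congr_fun (congrArg ModuleCat.Hom.hom hfg) m
    rw [ModuleCat.hom_sum, LinearMap.sum_apply] at this
    exact this
  have hz {k : ℤ} (z : Cochain (moduleDual J M) J k) :
      ∑ i, (Cochain.ofHom (moduleDualMap J (g i))).comp
        ((Cochain.ofHom (moduleDualMap J (f i))).comp z (zero_add k)) (zero_add k) = z := by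
    let F : (moduleDual J M ⟶ moduleDual J M) →+ Cochain (moduleDual J M) J k :=
      AddMonoidHom.mk' (fun φ => (Cochain.ofHom φ).comp z (zero_add k))
        (fun φ ψ => by rw [Cochain.ofHom_add, Cochain.add_comp])
    have h := congrArg F (sum_moduleDualMap hfg)
    rw [map_sum] at h
    refine Eq.trans (Finset.sum_congr rfl fun i _ => ?_) (h.trans (Cochain.id_comp z))
    rw [← Cochain.comp_assoc_of_first_is_zero_cochain, ← Cochain.ofHom_comp]
    rfl
  have hδ {k l : ℤ} (β : Fin n → Cochain (moduleDual J M) J k) :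
      δ k l (∑ i, β i) = ∑ i, δ k l (β i) := map_sum (δ_hom ℤ (moduleDual J M) J k l) β _
  let E : M →+ Cochain (moduleDual J M) J 0 :=
    AddMonoidHom.mk' (fun m => Cochain.ofHom (evaluation J m))
      (fun m m' => by rw [evaluation_add, Cochain.ofHom_add])
  refine ⟨fun m β hβ => ?_, fun z hz' => ?_, fun k hk z hz' => ?_⟩
  · rw [← hfg' m]
    refine Finset.sum_eq_zero fun i _ => ?_
    have : f i m = 0 := h.injective _
      ((Cochain.ofHom (moduleDualMap J (f i))).comp β (zero_add _)) (by
        rw [δ_ofHom_comp, hβ, ofHom_moduleDualMap_comp_evaluation])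
    rw [this]
    exact map_zero (g i).hom
  · choose a β h' using fun i => h.surjective
      ((Cochain.ofHom (moduleDualMap J (f i))).comp z (zero_add _)) (by
        rw [δ_ofHom_comp, hz', Cochain.comp_zero])
    refine ⟨∑ i, g i (a i),
      ∑ i, (Cochain.ofHom (moduleDualMap J (g i))).comp (β i) (zero_add _), ?_⟩
    change z = E _ + _
    rw [← hz z, hδ, map_sum, ← Finset.sum_add_distrib]
    refine Finset.sum_congr rfl fun i _ => ?_
    rw [h', Cochain.comp_add, ofHom_moduleDualMap_comp_evaluation, δ_ofHom_comp]
    rfl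
  · choose β h' using fun i => h.exact k hk
      ((Cochain.ofHom (moduleDualMap J (f i))).comp z (zero_add _)) (by
        rw [δ_ofHom_comp, hz', Cochain.comp_zero])
    refine ⟨∑ i, (Cochain.ofHom (moduleDualMap J (g i))).comp (β i) (zero_add _), ?_⟩
    rw [← hz z, hδ]
    exact Finset.sum_congr rfl fun i _ => by rw [δ_ofHom_comp, h']

/-- The isomorphism `Hom_A(A, J) ≅ J`. -/
def moduleDualSelfIso : moduleDual J (ModuleCat.of A A) ≅ J :=
  HomologicalComplex.Hom.isoOfComponents
    (fun n => (LinearMap.ringLmapEquivSelf A A (J.X n)).toModuleIso) (fun _ _ _ => rfl)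

lemma evaluation_one : evaluation J (1 : ModuleCat.of A A) = moduleDualSelfIso.hom := rfl

lemma EvaluationBijective.of_homothetyBijective
    (h : HomothetyBijective A (evaluation J (1 : ModuleCat.of A A))) :
    EvaluationBijective J (ModuleCat.of A A) := by
  have key (a : A) : Cochain.ofHom (evaluation J (show ModuleCat.of A A from a)) =
      a • Cochain.ofHom (evaluation J (1 : ModuleCat.of A A)) := by
    have : (show ModuleCat.of A A from a) = a • (1 : ModuleCat.of A A) := (mul_one a).symm
    rw [this, evaluation_smul]
    ext p
    simp
  refine ⟨fun a β hβ => h.injective a β (hβ.trans (key a)), fun z hz => ?_, h.exact⟩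
  obtain ⟨a, β, hβ⟩ := h.surjective z hz
  exact ⟨a, β, by rw [hβ]; exact congrArg (· + _) (key a).symm⟩

lemma finite_of_exact [IsNoetherianRing A] {S : ShortComplex (ModuleCat.{u} A)} (hS : S.Exact)
    (h₁ : Module.Finite A S.X₁) (h₃ : Module.Finite A S.X₃) : Module.Finite A S.X₂ := by
  have := isNoetherian_of_range_eq_ker S.f.hom S.g.hom hS.moduleCat_range_eq_ker
  infer_instance

/-- A dual basis embeds the cohomology of `Hom(M, J)` in a finite power of that of `Hom(A, J) ≅ J`.
-/
lemma finite_homology_moduleDual_of_projective [IsNoetherianRing A] (i : ℤ)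
    [Module.Finite A (J.homology i)] (M : ModuleCat.{u} A) [Module.Finite A M]
    [Module.Projective A M] : Module.Finite A ((moduleDual J M).homology i) := by
  obtain ⟨n, f, g, hfg⟩ := exists_dual_basis M
  let e : J.homology i ≅ (moduleDual J (ModuleCat.of A A)).homology i :=
    (HomologicalComplex.homologyFunctor _ _ i).mapIso moduleDualSelfIso.symm
  have : Module.Finite A ((moduleDual J (ModuleCat.of A A)).homology i) :=
    Module.Finite.equiv e.toLinearEquiv
  refine Module.Finite.of_injective (LinearMap.pi fun k =>
    (HomologicalComplex.homologyMap (moduleDualMap J (g k)) i).hom) ?_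
  rw [injective_iff_map_eq_zero]
  intro x hx
  have h : ∑ k, HomologicalComplex.homologyMap (moduleDualMap J (g k)) i ≫
      HomologicalComplex.homologyMap (moduleDualMap J (f k)) i = 𝟙 _ := by
    have := congrArg (HomologicalComplex.homologyFunctor _ _ i).map
      (sum_moduleDualMap (J := J) hfg)
    rw [Functor.map_sum, CategoryTheory.Functor.map_id] at this
    simp only [Functor.map_comp] at this
    exact this
  have h' := LinearMap.congr_fun (congrArg ModuleCat.Hom.hom h) x
  rw [ModuleCat.hom_sum, LinearMap.sum_apply] at h'
  refine h'.symm.trans (Finset.sum_eq_zero fun k _ => ?_)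
  have hk : (HomologicalComplex.homologyMap (moduleDualMap J (g k)) i) x = 0 := congrFun hx k
  exact (congrArg (HomologicalComplex.homologyMap (moduleDualMap J (f k)) i) hk).trans
    (map_zero (HomologicalComplex.homologyMap (moduleDualMap J (f k)) i).hom)

/-- Induction along `0 → K → A^n → M → 0`. For finiteness, `H^i(Hom(M, J))` lies between
`H^{i-1}(Hom(K, J))` and `H^i(Hom(A^n, J))` in the long exact sequence. -/
lemma evaluationBijective_and_finite_homology [IsNoetherianRing A]
    (hJ : ∀ n, Injective (J.X n)) (hfg : ∀ n, Module.Finite A (J.homology n))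
    (h : EvaluationBijective J (ModuleCat.of A A)) (k : ℕ)
    (M : ModuleCat.{u} A) [Module.Finite A M] (hM : HasProjectiveDimensionLT M (k + 1)) :
    EvaluationBijective J M ∧ ∀ n, Module.Finite A ((moduleDual J M).homology n) := by
  induction k generalizing M with
  | zero =>
    rw [zero_add, ← projective_iff_hasProjectiveDimensionLT_one] at hM
    have : Module.Projective A M := (IsProjective.iff_projective (R := A) M).2 hM
    exact ⟨h.of_projective M, fun n => finite_homology_moduleDual_of_projective n M⟩
  | succ k ih =>
    obtain ⟨n, p, hp⟩ := Module.Finite.exists_fin' A M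
    have hS := LinearMap.shortExact_shortComplexKer hp
    have hF : Module.Projective A (Fin n → A) := inferInstance
    have hK := (hS.hasProjectiveDimensionLT_X₃_iff k
      ((IsProjective.iff_projective (R := A) (Fin n → A)).1 inferInstance)).1 hM
    obtain ⟨h₁, h₁'⟩ := ih (ModuleCat.of A (LinearMap.ker p)) hK
    refine ⟨EvaluationBijective.of_shortExact hJ hS h₁
      (h.of_projective (ModuleCat.of A (Fin n → A))),
      fun i => ?_⟩
    have hT := shortExact_moduleDual hJ hS
    have h₂ := finite_homology_moduleDual_of_projective (J := J) i (ModuleCat.of A (Fin n → A))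
    have h1 := hT.homology_exact₁ (i - 1) i (by simp)
    exact finite_of_exact h1 (h₁' (i - 1)) h₂

end Evaluation

/-! ### Bounded injective resolutions over regular rings -/

section InjectiveResolution

variable {A : Type u} [CommRing A]

attribute [local instance] HasDerivedCategory.standard in
lemma HasFiniteGlobalDimension.exists_injective_resolution (h : HasFiniteGlobalDimension A)
    (N : ModuleCat.{u} A) :
    ∃ (J : Complexes A) (ι : inDegreeZero A N ⟶ J) (b : ℤ), QuasiIso ι ∧
      (∀ n, Injective (J.X n)) ∧ J.IsStrictlyGE 0 ∧ J.IsStrictlyLE b := by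
  obtain ⟨d, hd⟩ := h
  have : (inDegreeZero A N).IsStrictlyGE 0 :=
    (inferInstance : ((CochainComplex.singleFunctor (ModuleCat.{u} A) 0).obj N).IsStrictlyGE 0)
  obtain ⟨J, ι, h₁, h₂, h₃, h₄⟩ := exists_bounded_injective (inDegreeZero A N) 0 d
    (fun M i hi φ => by
      obtain ⟨n, rfl⟩ := Int.eq_ofNat_of_zero_le (show 0 ≤ i by lia)
      have := hd M N n (by lia)
      have hs : Subsingleton (ShiftedHom ((DerivedCategory.singleFunctor (ModuleCat.{u} A) 0).obj M)
          ((DerivedCategory.singleFunctor (ModuleCat.{u} A) 0).obj N) (n : ℤ)) :=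
        (Abelian.Ext.homEquiv (X := M) (Y := N) (n := n)).symm.subsingleton
      exact hs.elim φ 0)
    (fun i hi => HomologicalComplex.exactAt_single_obj _ _ _ _ (by lia))
  exact ⟨J, ι, d, h₁, h₂, h₃, h₄⟩

/-- `Hom(A, J)` is `J`, by evaluation at `1`; under this identification the claim is that `ι`
induces bijections on cohomology. -/
lemma homothetyBijective_of_quasiIso_single {J : Complexes A}
    (ι : inDegreeZero A (ModuleCat.of A A) ⟶ J) [hι : QuasiIso ι] : HomothetyBijective A ι := by
  let g : ModuleCat.of A A ⟶ J.X 0 :=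
    (HomologicalComplex.singleObjXSelf (ComplexShape.up ℤ) 0 _).inv ≫ ι.f 0
  have hg (k : ℤ) (_ : (ComplexShape.up ℤ).Rel 0 k) : g ≫ J.d 0 k = 0 := by
    simp [g]
  have hιg : ι = HomologicalComplex.mkHomFromSingle g hg :=
    HomologicalComplex.from_single_hom_ext (by simp [g])
  have hq : QuasiIso (HomologicalComplex.mkHomFromSingle g hg) := hιg ▸ hι
  obtain ⟨h₁, h₂, h₃⟩ := (quasiIso_mkHomFromSingle_iff g hg).1 hq
  let E (n : ℤ) : Cochain (inDegreeZero A (ModuleCat.of A A)) J n ≃+ (ModuleCat.of A A ⟶ J.X n) :=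
    Cochain.fromSingleEquiv (zero_add n)
  have hE (n m : ℤ) (z : Cochain (inDegreeZero A (ModuleCat.of A A)) J n) :
      E m (δ n m z) = E n z ≫ J.d n m := by
    obtain ⟨f, rfl⟩ := (E n).symm.surjective z
    have := Cochain.δ_fromSingleMk f (zero_add n) m m (zero_add m)
    rw [AddEquiv.apply_symm_apply, ← AddEquiv.eq_symm_apply]
    exact this
  have hEι (a : A) : E 0 (a • Cochain.ofHom ι) = a • g := by
    change _ ≫ (a • Cochain.ofHom ι).v 0 0 _ = _
    rw [Cochain.smul_v, Cochain.ofHom_v, Linear.comp_smul]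
  have hsmul (a : A) : (a • g) (1 : A) = g a := by
    have : (a • g) (1 : A) = g (a • (1 : A)) := (map_smul g.hom a (1 : A)).symm
    rw [this, smul_eq_mul, mul_one]
  let s {n : ℤ} (y : J.X n) : ModuleCat.of A A ⟶ J.X n :=
    ModuleCat.ofHom (LinearMap.toSpanSingleton A _ y)
  have hs {n : ℤ} (y : J.X n) : s y (1 : A) = y := one_smul A y
  have hext {n : ℤ} {f f' : ModuleCat.of A A ⟶ J.X n} (h : f (1 : A) = f' (1 : A)) : f = f' :=
    ModuleCat.hom_ext (LinearMap.ext_ring h)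
  refine ⟨fun a β hβ => ?_, fun z hz => ?_, fun n hn z hz => ?_⟩
  · have h := congrArg (E 0) hβ
    rw [hE, hEι] at h
    exact h₁ a (E (-1) β (1 : A)) ((ConcreteCategory.congr_hom h (1 : A)).trans (hsmul a))
  · have h := congrArg (E 1) hz
    rw [hE, map_zero] at h
    obtain ⟨a, y, hy⟩ := h₂ (E 0 z (1 : A)) (ConcreteCategory.congr_hom h (1 : A))
    refine ⟨a, (E (-1)).symm (s y), (E 0).injective (hext ?_)⟩
    rw [map_add, hE, hEι, AddEquiv.apply_symm_apply, hy]
    change _ = (a • g) (1 : A) + J.d (-1) 0 (s y (1 : A))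
    rw [hsmul, hs]
  · have h := congrArg (E (n + 1)) hz
    rw [hE, map_zero] at h
    obtain ⟨y, hy⟩ := (exactAt_iff_elements J (n - 1) n (n + 1) (by simp) rfl).1 (h₃ n hn)
      (E n z (1 : A)) (ConcreteCategory.congr_hom h (1 : A))
    refine ⟨(E (n - 1)).symm (s y), (E n).injective (hext ?_)⟩
    rw [hE, AddEquiv.apply_symm_apply, ← hy]
    change J.d (n - 1) n (s y (1 : A)) = _
    rw [hs]

end InjectiveResolution

/-! ### Adjunction for cochains -/

section Adjunction

variable {C D : Type*} [Category* C] [Category* D] [Preadditive C] [Preadditive D]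
  {G : C ⥤ D} {H : D ⥤ C} [G.Additive] [H.Additive] (adj : G ⊣ H)

/-- The counit of the adjunction, applied to a complex. -/
def counitMap (J : CochainComplex D ℤ) :
    (G.mapHomologicalComplex (ComplexShape.up ℤ)).obj
      ((H.mapHomologicalComplex (ComplexShape.up ℤ)).obj J) ⟶ J where
  f n := adj.counit.app (J.X n)
  comm' i j _ := (adj.counit.naturality (J.d i j)).symm

variable {K : CochainComplex C ℤ} {J : CochainComplex D ℤ} {n : ℤ}

/-- Transposition of cochains. -/
def transposeCochain (z : Cochain K ((H.mapHomologicalComplex (ComplexShape.up ℤ)).obj J) n) :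
    Cochain ((G.mapHomologicalComplex (ComplexShape.up ℤ)).obj K) J n :=
  (z.map G).comp (Cochain.ofHom (counitMap adj J)) (add_zero n)

lemma transposeCochain_v (z : Cochain K ((H.mapHomologicalComplex (ComplexShape.up ℤ)).obj J) n)
    (p q : ℤ) (hpq : p + n = q) :
    (transposeCochain adj z).v p q hpq = (adj.homEquiv _ _).symm (z.v p q hpq) := by
  have h := Cochain.comp_zero_cochain_v (z.map G) (Cochain.ofHom (counitMap adj J)) p q hpq
  rw [Cochain.ofHom_v] at h
  exact h.trans (adj.homEquiv_counit _ _ _).symm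

lemma transposeCochain_bijective : Function.Bijective (transposeCochain adj :
    Cochain K ((H.mapHomologicalComplex (ComplexShape.up ℤ)).obj J) n → _) := by
  constructor
  · intro z z' h
    refine Cochain.ext _ _ fun p q hpq => ?_
    have := Cochain.congr_v h p q hpq
    rw [transposeCochain_v, transposeCochain_v] at this
    exact (adj.homEquiv _ _).symm.injective this
  · intro w
    refine ⟨Cochain.mk fun p q hpq => adj.homEquiv _ _ (w.v p q hpq), ?_⟩
    refine Cochain.ext _ _ fun p q hpq => ?_
    rw [transposeCochain_v]
    exact (adj.homEquiv _ _).symm_apply_apply _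

lemma transposeCochain_add
    (z z' : Cochain K ((H.mapHomologicalComplex (ComplexShape.up ℤ)).obj J) n) :
    transposeCochain adj (z + z') = transposeCochain adj z + transposeCochain adj z' := by
  rw [transposeCochain, Cochain.map_add, Cochain.add_comp]
  rfl

lemma δ_transposeCochain
    (z : Cochain K ((H.mapHomologicalComplex (ComplexShape.up ℤ)).obj J) n) (m : ℤ) :
    δ n m (transposeCochain adj z) = transposeCochain adj (δ n m z) := by
  rw [transposeCochain, δ_comp_ofHom, δ_map]
  rfl

end Adjunction

/-! ### Coextension of scalars along a finite ring map, and the existence theorem -/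

section Coextension

open ModuleCat

variable {A B : Type u} [CommRing A] [CommRing B] (f : A →+* B)

instance coextendScalars_additive : (coextendScalars.{u, u, u} f).Additive :=
  (restrictCoextendScalarsAdj.{u, u, u} f).right_adjoint_additive

/-- The complex of `B`-modules `Hom_A(B, J)`. -/
def coextension (J : Complexes A) : Complexes B :=
  ((coextendScalars.{u, u, u} f).mapHomologicalComplex (ComplexShape.up ℤ)).obj J

/-- A complex of `B`-modules, seen as a complex of `A`-modules. -/
def restriction (K : Complexes B) : Complexes A :=
  ((restrictScalars.{u, u, u} f).mapHomologicalComplex (ComplexShape.up ℤ)).obj K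

variable (J : Complexes A)

/-- The two `A`-module structures on `Hom_A(B, M)` agree. -/
def coextendScalarsEquiv (M : ModuleCat.{u} A) :
    ((restrictScalars.{u, u, u} f).obj (ModuleCat.of B B) →ₗ[A] M) ≃ₗ[A]
      (restrictScalars.{u, u, u} f).obj ((coextendScalars.{u, u, u} f).obj M) where
  toFun φ := φ
  invFun φ := φ
  map_add' _ _ := rfl
  map_smul' a φ := LinearMap.ext fun s : B =>
    (φ.map_smul a s).symm.trans (congrArg φ (mul_comm (f a) s))
  left_inv _ := rfl
  right_inv _ := rfl

/-- The two descriptions of `Hom_A(B, J)`, as a complex of `A`-modules, agree. -/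
def moduleDualIsoRestriction :
    moduleDual J ((restrictScalars.{u, u, u} f).obj (ModuleCat.of B B)) ≅
      restriction f (coextension f J) :=
  HomologicalComplex.Hom.isoOfComponents
    (fun n => (coextendScalarsEquiv f (J.X n)).toModuleIso) (fun _ _ _ => rfl)

variable {J}

/-- Cochains with values in `Hom_A(B, J)` are cochains with values in `J`. -/
def coextensionCochain {n : ℤ} (z : Cochain (coextension f J) (coextension f J) n) :
    Cochain (moduleDual J ((restrictScalars.{u, u, u} f).obj (ModuleCat.of B B))) J n :=
  (Cochain.ofHom (moduleDualIsoRestriction f J).hom).comp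
    (transposeCochain (restrictCoextendScalarsAdj.{u, u, u} f) z) (zero_add n)

lemma coextensionCochain_add {n : ℤ} (z z' : Cochain (coextension f J) (coextension f J) n) :
    coextensionCochain f (z + z') = coextensionCochain f z + coextensionCochain f z' := by
  exact (congrArg (fun w => (Cochain.ofHom (moduleDualIsoRestriction f J).hom).comp w (zero_add n))
    (transposeCochain_add _ z z')).trans (Cochain.comp_add ..)

lemma δ_coextensionCochain {n : ℤ} (z : Cochain (coextension f J) (coextension f J) n) (m : ℤ) :
    δ n m (coextensionCochain f z) = coextensionCochain f (δ n m z) := by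
  exact (δ_ofHom_comp _ _ _).trans
    (congrArg (fun w => (Cochain.ofHom (moduleDualIsoRestriction f J).hom).comp w (zero_add m))
    (δ_transposeCochain _ z m))

lemma coextensionCochain_bijective {n : ℤ} : Function.Bijective (coextensionCochain f :
    Cochain (coextension f J) (coextension f J) n → _) := by
  refine Function.Bijective.comp (g := fun w : Cochain (restriction f (coextension f J)) J n =>
    (Cochain.ofHom (moduleDualIsoRestriction f J).hom).comp w (zero_add n)) ?_
    (transposeCochain_bijective (restrictCoextendScalarsAdj.{u, u, u} f))
  refine Function.bijective_iff_has_inverse.2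
    ⟨fun w => (Cochain.ofHom (moduleDualIsoRestriction f J).inv).comp w (zero_add n),
    fun w => ?_, fun w => ?_⟩
  · dsimp only
    rw [← Cochain.comp_assoc_of_first_is_zero_cochain, ← Cochain.ofHom_comp, Iso.inv_hom_id,
      Cochain.id_comp]
  · dsimp only
    rw [← Cochain.comp_assoc_of_first_is_zero_cochain, ← Cochain.ofHom_comp, Iso.hom_inv_id,
      Cochain.id_comp]

lemma coextensionCochain_apply {n : ℤ} (z : Cochain (coextension f J) (coextension f J) n)
    (p q : ℤ) (hpq : p + n = q)
    (φ : (restrictScalars.{u, u, u} f).obj (ModuleCat.of B B) →ₗ[A] J.X p) :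
    (coextensionCochain f z).v p q hpq φ =
      CoextendScalars.equiv f (J.X q) (z.v p q hpq (coextendScalarsEquiv f (J.X p) φ)) (1 : B) := by
  have h := Cochain.zero_cochain_comp_v (Cochain.ofHom (moduleDualIsoRestriction f J).hom)
    (transposeCochain (restrictCoextendScalarsAdj.{u, u, u} f) z) p q hpq
  rw [Cochain.ofHom_v] at h
  refine (ConcreteCategory.congr_hom h φ).trans ?_
  exact ConcreteCategory.congr_hom (transposeCochain_v (restrictCoextendScalarsAdj.{u, u, u} f) z
    p q hpq) (coextendScalarsEquiv f (J.X p) φ)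

/-- Under adjunction the homotheties of `Hom_A(B, J)` become the evaluations, so the canonical
morphism over `B` becomes biduality for the `A`-module `B`. -/
lemma coextensionCochain_smul_id (b : B) :
    coextensionCochain f (b • Cochain.ofHom (𝟙 (coextension f J))) =
      Cochain.ofHom (evaluation J
        (M := (restrictScalars.{u, u, u} f).obj (ModuleCat.of B B)) b) := by
  ext p φ
  refine (coextensionCochain_apply f _ p p (add_zero p) φ).trans ?_
  rw [Cochain.smul_v, Cochain.ofHom_v]
  refine (CoextendScalars.smul_apply f (J.X p) (coextendScalarsEquiv f (J.X p) φ) b 1).trans ?_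
  rw [one_mul, Cochain.ofHom_v]
  rfl

lemma homothetyBijective_coextension (h : EvaluationBijective J
    ((restrictScalars.{u, u, u} f).obj (ModuleCat.of B B))) :
    HomothetyBijective B (𝟙 (coextension f J)) := by
  have hinj {n : ℤ} := (coextensionCochain_bijective f (J := J) (n := n)).1
  have hsurj {n : ℤ} := (coextensionCochain_bijective f (J := J) (n := n)).2
  have hzero {n : ℤ} :
      coextensionCochain f (0 : Cochain (coextension f J) (coextension f J) n) = 0 :=
    map_zero (AddMonoidHom.mk' _ (coextensionCochain_add f))
  refine ⟨fun b β hβ => ?_, fun z hz => ?_, fun n hn z hz => ?_⟩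
  · exact h.injective b (coextensionCochain f β) (by
      rw [δ_coextensionCochain, hβ, coextensionCochain_smul_id])
  · obtain ⟨b, β, hb⟩ := h.surjective (coextensionCochain f z) (by
      rw [δ_coextensionCochain, hz, hzero])
    obtain ⟨β, rfl⟩ := hsurj β
    refine ⟨b, β, hinj ?_⟩
    rw [hb, coextensionCochain_add, δ_coextensionCochain]
    exact congrArg (· + _) (coextensionCochain_smul_id f b).symm
  · obtain ⟨β, hβ⟩ := h.exact n hn (coextensionCochain f z) (by
      rw [δ_coextensionCochain, hz, hzero])
    obtain ⟨β, rfl⟩ := hsurj β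
    exact ⟨β, hinj (by rw [← hβ, δ_coextensionCochain])⟩

lemma finite_of_finite_restrictScalars (M : ModuleCat.{u} B)
    (h : Module.Finite A ((restrictScalars.{u, u, u} f).obj M)) : Module.Finite B M := by
  let _ : Algebra A B := f.toAlgebra
  let _ : Module A M := inferInstanceAs (Module A ((restrictScalars f).obj M))
  have : IsScalarTower A B M := ⟨fun a b x => by
    rw [Algebra.smul_def, mul_smul]
    rfl⟩
  have : Module.Finite A M := h
  exact Module.Finite.of_restrictScalars_finite A B M

lemma hasFGCohomology_coextension (h : ∀ n, Module.Finite A ((moduleDual J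
    ((restrictScalars.{u, u, u} f).obj (ModuleCat.of B B))).homology n)) :
    HasFGCohomology (coextension f J) := by
  intro n
  refine finite_of_finite_restrictScalars f _ ?_
  let e₁ : (moduleDual J ((restrictScalars.{u, u, u} f).obj (ModuleCat.of B B))).homology n ≅
      (restriction f (coextension f J)).homology n :=
    (HomologicalComplex.homologyFunctor _ _ n).mapIso (moduleDualIsoRestriction f J)
  let e₂ : (restriction f (coextension f J)).homology n ≅
      (restrictScalars.{u, u, u} f).obj ((coextension f J).homology n) :=
    ((coextension f J).sc n).mapHomologyIso (restrictScalars.{u, u, u} f)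
  have := h n
  exact Module.Finite.equiv (e₁ ≪≫ e₂).toLinearEquiv

attribute [local instance] HasDerivedCategory.standard in
/-- If `B` is finite over `A` regular, then `Hom_A(B, J)` is dualizing, for an injective
resolution `J` of `A`. -/
lemma exists_isDualizing_of_finite [IsNoetherianRing A] (hA : HasFiniteGlobalDimension A)
    (hf : f.Finite) : ∃ R : Complexes B, IsDualizing R := by
  obtain ⟨J, ι, b, hι, hJ, h₀, hb⟩ := hA.exists_injective_resolution (ModuleCat.of A A)
  have := isKInjective_of_injective J 0
  have hfg (n : ℤ) : Module.Finite A (J.homology n) := by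
    have : Module.Finite A ((inDegreeZero A (ModuleCat.of A A)).homology n) := by
      by_cases hn : n = 0
      · subst hn
        have : Module.Finite A (ModuleCat.of A A) := inferInstanceAs (Module.Finite A A)
        exact Module.Finite.equiv (HomologicalComplex.singleObjHomologySelfIso
          (ComplexShape.up ℤ) 0 (ModuleCat.of A A)).symm.toLinearEquiv
      · have := (subsingleton_homology_iff _ _).2
          (HomologicalComplex.exactAt_single_obj (ComplexShape.up ℤ) 0 (ModuleCat.of A A) n hn)
        infer_instance
    exact Module.Finite.equiv (asIso (HomologicalComplex.homologyMap ι n)).toLinearEquiv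
  -- Evaluation at `1` is the isomorphism `Hom_A(A, J) ≅ J`, and `ι` is a quasi-isomorphism to the
  -- same `J`, so the homothety condition passes from `ι` to it.
  have hA' : EvaluationBijective J (ModuleCat.of A A) := by
    have : QuasiIso (evaluation J (1 : ModuleCat.of A A)) := by
      rw [evaluation_one]
      infer_instance
    exact .of_homothetyBijective
      ((homothetyBijective_of_quasiIso_single ι).of_quasiIso _ (Iso.refl _))
  obtain ⟨d, hd⟩ := hasFiniteGlobalDimension_iff.1 hA
  have hB : Module.Finite A ((restrictScalars.{u, u, u} f).obj (ModuleCat.of B B)) := hf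
  obtain ⟨h₁, h₂⟩ := evaluationBijective_and_finite_homology hJ hfg hA' d
    ((restrictScalars.{u, u, u} f).obj (ModuleCat.of B B)) (hd _)
  have hGE : (coextension f J).IsStrictlyGE 0 := by
    rw [isStrictlyGE_iff]
    exact fun n hn => (coextendScalars.{u, u, u} f).map_isZero (J.isZero_of_isStrictlyGE 0 n hn)
  have hLE : (coextension f J).IsStrictlyLE b := by
    rw [isStrictlyLE_iff]
    exact fun n hn => (coextendScalars.{u, u, u} f).map_isZero (J.isZero_of_isStrictlyLE b n hn)
  -- Coextension is right adjoint to the exact functor of restriction, so it preserves injectives.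
  have hinj (n : ℤ) : Injective ((coextension f J).X n) :=
    (restrictCoextendScalarsAdj.{u, u, u} f).map_injective _ (hJ n)
  have := isKInjective_of_injective (coextension f J) 0
  refine ⟨coextension f J, ⟨0, b, fun i hi => ?_⟩, hasFGCohomology_coextension f h₂,
    hasFiniteInjectiveDimension_of_quasiIso b (𝟙 _), ?_⟩
  · rw [subsingleton_homology_iff]
    obtain hi | hi := hi
    · exact ShortComplex.exact_of_isZero_X₂ _ ((coextension f J).isZero_of_isStrictlyGE 0 i hi)
    · exact ShortComplex.exact_of_isZero_X₂ _ ((coextension f J).isZero_of_isStrictlyLE b i hi)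
  · rw [canonicalMorphismIsIso_iff _ (𝟙 _)]
    exact homothetyBijective_coextension f h₁

end Coextension

/-- `B` is a localization of a subalgebra of finite type. That subalgebra is a quotient of a regular
ring, hence finite over it, and localization preserves its dualizing complex. -/
lemma exists_isDualizing_of_essFiniteType {A : Type u} [CommRing A] [IsNoetherianRing A]
    (hA : HasFiniteGlobalDimension A) (B : Type u) [CommRing B] [Algebra A B]
    [Algebra.EssFiniteType A B] : ∃ R : Complexes B, IsDualizing R := by
  obtain ⟨P, _, _, f, hf, hP⟩ := exists_regular_surjective hA (Algebra.EssFiniteType.subalgebra A B)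
  obtain ⟨R, hR⟩ := exists_isDualizing_of_finite f hP (RingHom.Finite.of_surjective f hf)
  have : IsNoetherianRing (Algebra.EssFiniteType.subalgebra A B) :=
    isNoetherianRing_of_surjective P _ f hf
  exact ⟨_, isDualizing_baseChange (Algebra.EssFiniteType.submonoid A B) B hR⟩

end DualizingComplex

end

theorem mainTheorem12 :
    (∀ (A : Type u) [CommRing A] [IsNoetherianRing A] (S : Submonoid A)
      (B : Type u) [CommRing B] [Algebra A B] [IsLocalization S B]
      (R : DualizingComplex.Complexes A),
      DualizingComplex.IsDualizing R →
        DualizingComplex.IsDualizing (DualizingComplex.baseChange B R)) ∧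
    (∀ (A : Type u) [CommRing A] [IsNoetherianRing A]
      (B : Type u) [CommRing B] [Algebra A B] [Algebra.EssFiniteType A B],
      DualizingComplex.HasFiniteGlobalDimension A →
        ∃ R : DualizingComplex.Complexes B, DualizingComplex.IsDualizing R) :=
  ⟨fun _ _ _ S B _ _ _ _ hR => DualizingComplex.isDualizing_baseChange S B hR,
    fun _ _ _ B _ _ _ hA => DualizingComplex.exists_isDualizing_of_essFiniteType hA B⟩
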